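/- Let $\alpha,\beta\in\mathbb R$, $\varepsilon\in\{0,1\}$, let $C(u)$ be a complex function of class $C^3$, $D(u)$ a real function of class $C^2$ and $H(\zeta,\bar\zeta,u)$ a real function of class $C^2$, given for $(\zeta,u)$ in an open set $S\subseteq\mathbb C\times\mathbb R$ (and $u$ in the projection of $S$), and put $$P=1+\alpha\zeta\bar\zeta,\qquad Q=(1+\beta\zeta\bar\zeta)\varepsilon+C\zeta+\bar C\bar\zeta,\qquad F=D\frac{Q^2}{P^2}v^2-\frac{(Q^2)_{,u}}{P^2}v-\frac QP H .$$ Assume $P\ne0$ and $Q\neq 0$ on $S$. On $M=\{(\zeta,u,v):(\zeta,u)\in S,\ v\in\mathbb R\}$ consider the Lorentzian metric of signature $(-,+,+,+)$ $$ds^2=\frac{2}{P^2}\,d\zeta\,d\bar\zeta-2\frac{Q^2}{P^2}\,du\,dv+F\,du^2 ,$$ with the vectors $$\mathbf m=P\,\partial_{\bar\zeta},\quad \bar{\mathbf m}=P\,\partial_\zeta,\quad \mathbf l=\frac{P^4}{2Q^4}F\,\partial_v+\frac{P^2}{Q^2}\,\partial_u,\quad \mathbf k=\partial_v .$$ Conventions: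 $R^a{}_{bcd}=\partial_c\Gamma^a_{bd}-\partial_d\Gamma^a_{bc}+\Gamma^a_{ce}\Gamma^e_{bd}-\Gamma^a_{de}\Gamma^e_{bc}$, $R_{bd}=R^a{}_{bad}$, $S_{ab}=R_{ab}-\frac14Rg_{ab}$, $C_{abcd}$ is the Weyl tensor; $\kappa=-k_{a;b}m^ak^b$, $\rho=-k_{a;b}m^a\bar m^b$, $\sigma=-k_{a;b}m^am^b$; $\Psi_0=C_{abcd}k^am^bk^cm^d$, $\Psi_1=C_{abcd}k^al^bk^cm^d$, $\Psi_2=C_{abcd}k^am^b\bar m^cl^d$, $\Psi_3=C_{abcd}k^al^b\bar m^cl^d$, $\Psi_4=C_{abcd}\bar m^al^b\bar m^cl^d$; $\Phi_{00}=\frac12S_{ab}k^ak^b$, $\Phi_{01}=\overline{\Phi_{10}}=\frac12S_{ab}k^am^b$, $\Phi_{02}=\overline{\Phi_{20}}=\frac12S_{ab}m^am^b$, $\Phi_{11}=\frac14S_{ab}(k^al^b+m^a\bar m^b)$, $\Phi_{12}=\overline{\Phi_{21}}=\frac12S_{ab}l^am^b$, $\Phi_{22}=\frac12S_{ab}l^al^b$.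 Then: (1) $(\mathbf m,\bar{\mathbf m},\mathbf l,\mathbf k)$ is a null tetrad on $M$: its only non-zero scalar products are $\mathbf m\cdot\bar{\mathbf m}=1$ and $\mathbf k\cdot\mathbf l=-1$. The spin coefficients $\rho,\sigma,\kappa$ vanish identically; $\mathbf k$ is a geodesic, non-expanding, twist-free and shear-free null vector field, so the metric belongs to the Kundt class; and $\mathbf k$ spans a principal null direction of multiplicity at least two ($C_{abc[d}k_{f]}k^bk^c=0$). (2) $\Psi_0=\Psi_1=\Psi_3=0$, $\Phi_{00}=\Phi_{01}=\Phi_{10}=\Phi_{02}=\Phi_{20}=\Phi_{12}=\Phi_{21}=0$, and $$\Psi_2=-\tfrac16(D+2\varepsilon\beta-2C\bar C)\frac{P^2}{Q^2},\qquad \Psi_4=\tfrac12(PH)_{,\zeta\zeta}\frac{P^4}{Q^3},$$ $$R=24\alpha-12\varepsilon(\alpha+\beta)\frac PQ+2(D+2\varepsilon\beta-2C\bar C)\frac{P^2}{Q^2},$$ $$\Phi_{11}=\tfrac12\varepsilon(\alpha+\beta)\frac PQ-\tfrac14(D+2\varepsilon\beta-2C\bar C)\frac{P^2}{Q^2},$$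 $$\Phi_{22}=\tfrac12\Big\{\big[\varepsilon(\alpha-\beta)(1-\alpha\zeta\bar\zeta)+2\alpha(C\zeta+\bar C\bar\zeta)\big]H+P^2Q\,H_{,\zeta\bar\zeta}-2\varepsilon(\alpha+\beta)\,v\,(\dot C\zeta+\dot{\bar C}\bar\zeta)\Big\}\frac{P^3}{Q^4}.$$ (3) Let $D_0=-2\varepsilon\beta+2C\bar C$. At each point of $M$, $\Psi_2=0$ if and only if $D=D_0$ there, and the Petrov type (the multiplicities of the principal null directions: $2,1,1$ for II; $2,2$ for D; $4$ for N; vanishing Weyl tensor for O) is II if $D\ne D_0$ and $\Psi_4\neq0$, D if $D\neq D_0$ and $\Psi_4=0$, N if $D=D_0$ and $\Psi_4\ne0$; it is O if and only if $D=D_0$ and $\Psi_4=0$. (4) Write $H=H_0$ if on $S$ $$H=\frac{A_0+A_1\zeta+\bar A_1\bar\zeta+A_2\zeta\bar\zeta}{1+\alpha\zeta\bar\zeta}$$ for some real functions $A_0,A_2$ and some complex function $A_1$ of $u$. If $H=H_0$, then $\Psi_4=0$ on $M$, and the Petrov type is O at the points where $D=D_0$ and D at the points where $D\neq D_0$. If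 $H$ is not of this form, and for every $u$ the slice $\{\zeta:(\zeta,u)\in S\}$ is connected (or empty), then there is a non-empty open subset of $M$ on which $\Psi_4\neq0$, and there the Petrov type is N at the points where $D=D_0$ and II at the points where $D\ne D_0$. -/

import Mathlib

noncomputable section

namespace KundtWaves

/-! Four-dimensional Lorentzian geometry in one chart, signature `(-,+,+,+)`. -/

/-- Coordinate points, and also real tangent vectors (through their components). -/
abbrev Coord := Fin 4 → ℝ

/-- A field of symmetric `4 × 4` matrices `g_ab`. -/
abbrev MetricField := Coord → Matrix (Fin 4) (Fin 4) ℝ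

/-- The partial derivative `∂_i f` at `x`. -/
def pderiv (i : Fin 4) (f : Coord → ℝ) (x : Coord) : ℝ :=
  fderiv ℝ f x (Pi.single i 1)

/-- Christoffel symbols of the Levi-Civita connection, `Γ^a_{bc}`. -/
def christoffel (g : MetricField) (x : Coord) (a b c : Fin 4) : ℝ :=
  ∑ d, (1 / 2) * (g x)⁻¹ a d *
    (pderiv b (fun y => g y d c) x + pderiv c (fun y => g y d b) x
      - pderiv d (fun y => g y b c) x)

/-- The curvature tensor `R^a_{bcd} = ∂_c Γ^a_{bd} - ∂_d Γ^a_{bc} + Γ^a_{ce} Γ^e_{bd}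
- Γ^a_{de} Γ^e_{bc}`. -/
def riemannUp (g : MetricField) (x : Coord) (a b c d : Fin 4) : ℝ :=
  pderiv c (fun y => christoffel g y a b d) x - pderiv d (fun y => christoffel g y a b c) x
    + ∑ e, (christoffel g x a c e * christoffel g x e b d
      - christoffel g x a d e * christoffel g x e b c)

/-- The covariant curvature tensor `R_{abcd}`. -/
def riemann (g : MetricField) (x : Coord) (a b c d : Fin 4) : ℝ :=
  ∑ e, g x a e * riemannUp g x e b c d

/-- The Ricci tensor `R_{bd} = R^a_{bad}`. -/
def ricci (g : MetricField) (x : Coord) (b d : Fin 4) : ℝ :=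
  ∑ a, riemannUp g x a b a d

/-- The Ricci scalar `R`. -/
def scalarCurv (g : MetricField) (x : Coord) : ℝ :=
  ∑ a, ∑ b, (g x)⁻¹ a b * ricci g x a b

/-- The trace-free part of the Ricci tensor, `S_{ab} = R_{ab} - R g_{ab} / 4`. -/
def traceFreeRicci (g : MetricField) (x : Coord) (a b : Fin 4) : ℝ :=
  ricci g x a b - scalarCurv g x / 4 * g x a b

/-- The Weyl tensor `C_{abcd}`. -/
def weyl (g : MetricField) (x : Coord) (a b c d : Fin 4) : ℝ :=
  riemann g x a b c d
    - (1 / 2) * (g x a c * ricci g x b d - g x a d * ricci g x b c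
        - g x b c * ricci g x a d + g x b d * ricci g x a c)
    + scalarCurv g x / 6 * (g x a c * g x b d - g x a d * g x b c)

/-- `∇_b X_a`, i.e. `X_{a;b}`, for a vector field `X^a`. -/
def covDerivLower (g : MetricField) (X : Coord → Fin 4 → ℝ) (x : Coord) (a b : Fin 4) : ℝ :=
  ∑ c, g x a c * (pderiv b (fun y => X y c) x + ∑ d, christoffel g x c b d * X x d)

/-- Contraction of a two-index tensor with two complex vectors. -/
def contract2 (T : Fin 4 → Fin 4 → ℝ) (X Y : Fin 4 → ℂ) : ℂ :=
  ∑ a, ∑ b, (T a b : ℂ) * X a * Y b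

/-- Contraction of a four-index tensor with four complex vectors. -/
def contract4 (T : Fin 4 → Fin 4 → Fin 4 → Fin 4 → ℝ) (X Y Z W : Fin 4 → ℂ) : ℂ :=
  ∑ a, ∑ b, ∑ c, ∑ d, (T a b c d : ℂ) * X a * Y b * Z c * W d

/-- A real vector as a complex one. -/
def toC (X : Fin 4 → ℝ) : Fin 4 → ℂ := fun a => (X a : ℂ)

/-- The complex conjugate vector. -/
def bar (X : Fin 4 → ℂ) : Fin 4 → ℂ := fun a => (starRingEnd ℂ) (X a)

/-- `(m, m̄, l, k)` with real `l`, `k` is a null tetrad of the bilinear form `g`: the only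
non-zero scalar products are `g(m, m̄) = 1` and `g(k, l) = -1`. -/
structure IsNullTetrad (g : Fin 4 → Fin 4 → ℝ) (m : Fin 4 → ℂ) (l k : Fin 4 → ℝ) : Prop where
  g_mm : contract2 g m m = 0
  g_mmbar : contract2 g m (bar m) = 1
  g_ml : contract2 g m (toC l) = 0
  g_mk : contract2 g m (toC k) = 0
  g_ll : contract2 g (toC l) (toC l) = 0
  g_kl : contract2 g (toC k) (toC l) = -1
  g_kk : contract2 g (toC k) (toC k) = 0

/-! Newman--Penrose quantities at `x` of the tetrad `(m, m̄, l, k)`. -/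

section NewmanPenrose

variable (g : MetricField) (m : Coord → Fin 4 → ℂ) (l k : Coord → Fin 4 → ℝ) (x : Coord)

/-- `κ = - k_{a;b} m^a k^b` -/
def spinKappa : ℂ := -contract2 (covDerivLower g k x) (m x) (toC (k x))

/-- `ρ = - k_{a;b} m^a m̄^b` -/
def spinRho : ℂ := -contract2 (covDerivLower g k x) (m x) (bar (m x))

/-- `σ = - k_{a;b} m^a m^b` -/
def spinSigma : ℂ := -contract2 (covDerivLower g k x) (m x) (m x)

/-- `Ψ₀ = C_{abcd} k^a m^b k^c m^d` -/
def Psi0 : ℂ := contract4 (weyl g x) (toC (k x)) (m x) (toC (k x)) (m x)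

/-- `Ψ₁ = C_{abcd} k^a l^b k^c m^d` -/
def Psi1 : ℂ := contract4 (weyl g x) (toC (k x)) (toC (l x)) (toC (k x)) (m x)

/-- `Ψ₂ = C_{abcd} k^a m^b m̄^c l^d` -/
def Psi2 : ℂ := contract4 (weyl g x) (toC (k x)) (m x) (bar (m x)) (toC (l x))

/-- `Ψ₃ = C_{abcd} k^a l^b m̄^c l^d` -/
def Psi3 : ℂ := contract4 (weyl g x) (toC (k x)) (toC (l x)) (bar (m x)) (toC (l x))

/-- `Ψ₄ = C_{abcd} m̄^a l^b m̄^c l^d` -/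
def Psi4 : ℂ := contract4 (weyl g x) (bar (m x)) (toC (l x)) (bar (m x)) (toC (l x))

/-- `Φ₀₀ = S_{ab} k^a k^b / 2` -/
def Phi00 : ℂ := (1 / 2) * contract2 (traceFreeRicci g x) (toC (k x)) (toC (k x))

/-- `Φ₀₁ = S_{ab} k^a m^b / 2` -/
def Phi01 : ℂ := (1 / 2) * contract2 (traceFreeRicci g x) (toC (k x)) (m x)

/-- `Φ₁₀ = S_{ab} k^a m̄^b / 2` -/
def Phi10 : ℂ := (1 / 2) * contract2 (traceFreeRicci g x) (toC (k x)) (bar (m x))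

/-- `Φ₀₂ = S_{ab} m^a m^b / 2` -/
def Phi02 : ℂ := (1 / 2) * contract2 (traceFreeRicci g x) (m x) (m x)

/-- `Φ₂₀ = S_{ab} m̄^a m̄^b / 2` -/
def Phi20 : ℂ := (1 / 2) * contract2 (traceFreeRicci g x) (bar (m x)) (bar (m x))

/-- `Φ₁₁ = S_{ab} (k^a l^b + m^a m̄^b) / 4` -/
def Phi11 : ℂ :=
  (1 / 4) * (contract2 (traceFreeRicci g x) (toC (k x)) (toC (l x))
    + contract2 (traceFreeRicci g x) (m x) (bar (m x)))

/-- `Φ₁₂ = S_{ab} l^a m^b / 2` -/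
def Phi12 : ℂ := (1 / 2) * contract2 (traceFreeRicci g x) (toC (l x)) (m x)

/-- `Φ₂₁ = S_{ab} l^a m̄^b / 2` -/
def Phi21 : ℂ := (1 / 2) * contract2 (traceFreeRicci g x) (toC (l x)) (bar (m x))

/-- `Φ₂₂ = S_{ab} l^a l^b / 2` -/
def Phi22 : ℂ := (1 / 2) * contract2 (traceFreeRicci g x) (toC (l x)) (toC (l x))

end NewmanPenrose

/-! The Kundt class. -/

/-- The value `T(X, Y)` of a real bilinear form. -/
def bilin (T : Fin 4 → Fin 4 → ℝ) (X Y : Fin 4 → ℝ) : ℝ := ∑ a, ∑ b, T a b * X a * Y b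

/-- `e₁, e₂` is an orthonormal basis of a (spacelike) screen space orthogonal to `k`. -/
def IsScreen (g : Fin 4 → Fin 4 → ℝ) (k e₁ e₂ : Fin 4 → ℝ) : Prop :=
  bilin g e₁ e₁ = 1 ∧ bilin g e₂ e₂ = 1 ∧ bilin g e₁ e₂ = 0 ∧ bilin g k e₁ = 0 ∧ bilin g k e₂ = 0

/-- On the domain `M`, the field `k` is a smooth nowhere vanishing null vector field which is
geodesic, non-expanding, twist-free and shear-free. The optical quantities are read off from
`∇_b k_a` restricted to the screen spaces. -/
structure IsKundtCongruence (g : MetricField) (M : Set Coord) (k : Coord → Fin 4 → ℝ) : Prop where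
  smooth : ContDiffOn ℝ ((⊤ : ℕ∞) : WithTop ℕ∞) k M
  ne_zero : ∀ x ∈ M, k x ≠ 0
  null : ∀ x ∈ M, bilin (g x) (k x) (k x) = 0
  geodesic : ∀ x ∈ M, ∃ f : ℝ, ∀ a,
    ∑ b, covDerivLower g k x a b * k x b = f * ∑ b, g x a b * k x b
  nonexpanding : ∀ x ∈ M, ∀ e₁ e₂, IsScreen (g x) (k x) e₁ e₂ →
    bilin (covDerivLower g k x) e₁ e₁ + bilin (covDerivLower g k x) e₂ e₂ = 0
  twistfree : ∀ x ∈ M, ∀ e₁ e₂, IsScreen (g x) (k x) e₁ e₂ →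
    bilin (covDerivLower g k x) e₁ e₂ - bilin (covDerivLower g k x) e₂ e₁ = 0
  shearfree : ∀ x ∈ M, ∀ e₁ e₂, IsScreen (g x) (k x) e₁ e₂ →
    bilin (covDerivLower g k x) e₁ e₁ - bilin (covDerivLower g k x) e₂ e₂ = 0 ∧
    bilin (covDerivLower g k x) e₁ e₂ + bilin (covDerivLower g k x) e₂ e₁ = 0

/-- The metric `g` on the domain `M` belongs to the Kundt class. -/
def InKundtClass (g : MetricField) (M : Set Coord) : Prop := ∃ k, IsKundtCongruence g M k

/-! Principal null directions and Petrov types, by the Bel--Debever criteria for a Weyl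
tensor `C` at one point with metric `g`. -/

/-- For a null vector `k ≠ 0`: `k` spans a principal null direction of `C` of multiplicity at
least `n`, where `n ≤ 4`. With `k_a = g_{ab} k^b` the criteria are
* `n = 1`: `k_[e C_a]bc[d k_f] k^b k^c = 0`;
* `n = 2`: `C_abc[d k_f] k^b k^c = 0`;
* `n = 3`: `C_abc[d k_f] k^c = 0`;
* `n = 4`: `C_abcd k^c = 0`.
-/
def PNDMultiplicityGE (g : Fin 4 → Fin 4 → ℝ) (C : Fin 4 → Fin 4 → Fin 4 → Fin 4 → ℝ)
    (k : Fin 4 → ℝ) (n : ℕ) : Prop :=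
  let kd : Fin 4 → ℝ := fun a => ∑ b, g a b * k b
  let T : Fin 4 → Fin 4 → ℝ := fun a d => ∑ b, ∑ c, C a b c d * k b * k c
  match n with
  | 0 => True
  | 1 => ∀ e a d f, kd e * T a d * kd f - kd a * T e d * kd f
      - kd e * T a f * kd d + kd a * T e f * kd d = 0
  | 2 => ∀ a d f, T a d * kd f - T a f * kd d = 0
  | 3 => ∀ a b d f, (∑ c, C a b c d * k c) * kd f - (∑ c, C a b c f * k c) * kd d = 0
  | 4 => ∀ a b d, ∑ c, C a b c d * k c = 0
  | _ => False

/-- The null direction spanned by `k` is a principal null direction of multiplicity exactly `n`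
(for `1 ≤ n ≤ 4` and `C ≠ 0`). -/
def IsPND (g : Fin 4 → Fin 4 → ℝ) (C : Fin 4 → Fin 4 → Fin 4 → Fin 4 → ℝ)
    (k : Fin 4 → ℝ) (n : ℕ) : Prop :=
  k ≠ 0 ∧ bilin g k k = 0 ∧ PNDMultiplicityGE g C k n ∧ ¬ PNDMultiplicityGE g C k (n + 1)

/-- Two vectors span different directions. -/
def DistinctDir (X Y : Fin 4 → ℝ) : Prop := LinearIndependent ℝ ![X, Y]

/-- The Petrov types. -/
inductive PetrovType
  | I | II | D | III | N | O

/-- The Weyl tensor `C` has the given Petrov type: the principal null directions have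
multiplicities `1,1,1,1` (type I), `2,1,1` (type II), `2,2` (type D), `3,1` (type III), `4`
(type N), and `C = 0` for type O. -/
def HasPetrovType (g : Fin 4 → Fin 4 → ℝ) (C : Fin 4 → Fin 4 → Fin 4 → Fin 4 → ℝ) :
    PetrovType → Prop
  | .O => ∀ a b c d, C a b c d = 0
  | .N => (∃ a b c d, C a b c d ≠ 0) ∧ ∃ k₁, IsPND g C k₁ 4
  | .III => (∃ a b c d, C a b c d ≠ 0) ∧ ∃ k₁ k₂, DistinctDir k₁ k₂ ∧ IsPND g C k₁ 3 ∧ IsPND g C k₂ 1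
  | .D => (∃ a b c d, C a b c d ≠ 0) ∧ ∃ k₁ k₂, DistinctDir k₁ k₂ ∧ IsPND g C k₁ 2 ∧ IsPND g C k₂ 2
  | .II => (∃ a b c d, C a b c d ≠ 0) ∧ ∃ k₁ k₂ k₃,
      DistinctDir k₁ k₂ ∧ DistinctDir k₁ k₃ ∧ DistinctDir k₂ k₃ ∧
      IsPND g C k₁ 2 ∧ IsPND g C k₂ 1 ∧ IsPND g C k₃ 1
  | .I => (∃ a b c d, C a b c d ≠ 0) ∧ ∃ k : Fin 4 → Fin 4 → ℝ,
      (∀ i j, i ≠ j → DistinctDir (k i) (k j)) ∧ ∀ i, IsPND g C (k i) 1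

/-! Complex derivatives in the plane. -/

/-- `∂f/∂ζ = (∂_x f - i ∂_y f) / 2` for `ζ = x + i y`. -/
def dZeta (f : ℂ → ℂ) (z : ℂ) : ℂ :=
  (1 / 2) * (fderiv ℝ f z 1 - Complex.I * fderiv ℝ f z Complex.I)

/-- `∂f/∂ζ̄ = (∂_x f + i ∂_y f) / 2` for `ζ = x + i y`. -/
def dZetaBar (f : ℂ → ℂ) (z : ℂ) : ℂ :=
  (1 / 2) * (fderiv ℝ f z 1 + Complex.I * fderiv ℝ f z Complex.I)

/-! The family of metrics. -/

/-- The parameters and functions of the family. -/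
structure WaveData where
  α : ℝ
  β : ℝ
  ε : ℝ
  C : ℝ → ℂ
  D : ℝ → ℝ
  H : ℂ → ℝ → ℝ

/-- The complex coordinate `ζ = x⁰ + i x¹`. -/
def zetaOf (x : Coord) : ℂ := ⟨x 0, x 1⟩

/-- The coordinate `u = x²`. -/
def uOf (x : Coord) : ℝ := x 2

/-- The coordinate `v = x³`. -/
def vOf (x : Coord) : ℝ := x 3

namespace WaveData

variable (w : WaveData)

/-- `P = 1 + α ζ ζ̄` -/
def P (ζ : ℂ) : ℝ := 1 + w.α * Complex.normSq ζ

/-- `Q = (1 + β ζ ζ̄) ε + C ζ + C̄ ζ̄`; here `C ζ + C̄ ζ̄ = 2 Re (C ζ)`. -/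
def Q (ζ : ℂ) (u : ℝ) : ℝ := (1 + w.β * Complex.normSq ζ) * w.ε + 2 * (w.C u * ζ).re

/-- `F = D (Q²/P²) v² - ((Q²)_{,u}/P²) v - (Q/P) H` -/
def F (ζ : ℂ) (u v : ℝ) : ℝ :=
  w.D u * (w.Q ζ u ^ 2 / w.P ζ ^ 2) * v ^ 2
    - deriv (fun s => w.Q ζ s ^ 2) u / w.P ζ ^ 2 * v
    - w.Q ζ u / w.P ζ * w.H ζ u

/-- The metric `ds² = 2 dζ dζ̄ / P² - 2 (Q²/P²) du dv + F du²` in the real coordinates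
`(Re ζ, Im ζ, u, v)`, where `dζ dζ̄ = (dx⁰)² + (dx¹)²`. -/
def metric : MetricField := fun x =>
  let P := w.P (zetaOf x)
  let Q := w.Q (zetaOf x) (uOf x)
  let F := w.F (zetaOf x) (uOf x) (vOf x)
  !![2 / P ^ 2, 0, 0, 0;
     0, 2 / P ^ 2, 0, 0;
     0, 0, F, -(Q ^ 2 / P ^ 2);
     0, 0, -(Q ^ 2 / P ^ 2), 0]

/-- `m = P ∂_ζ̄ = (P/2) (∂_0 + i ∂_1)` -/
def m : Coord → Fin 4 → ℂ := fun x =>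
  ![(w.P (zetaOf x) : ℂ) / 2, (w.P (zetaOf x) : ℂ) / 2 * Complex.I, 0, 0]

/-- `l = (P⁴ / (2 Q⁴)) F ∂_v + (P²/Q²) ∂_u` -/
def l : Coord → Fin 4 → ℝ := fun x =>
  let P := w.P (zetaOf x)
  let Q := w.Q (zetaOf x) (uOf x)
  ![0, 0, P ^ 2 / Q ^ 2, P ^ 4 / (2 * Q ^ 4) * w.F (zetaOf x) (uOf x) (vOf x)]

/-- `D₀ = -2 ε β + 2 C C̄` -/
def D₀ (u : ℝ) : ℝ := -2 * w.ε * w.β + 2 * Complex.normSq (w.C u)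

/-- `H = H₀` on the set `S` of pairs `(ζ, u)`, i.e.
`H = (A₀ + A₁ ζ + Ā₁ ζ̄ + A₂ ζ ζ̄) / (1 + α ζ ζ̄)` for some real functions `A₀`, `A₂` and some
complex function `A₁` of `u`; here `A₁ ζ + Ā₁ ζ̄ = 2 Re (A₁ ζ)`. -/
def IsH₀ (S : Set (ℂ × ℝ)) : Prop :=
  ∃ (A₀ A₂ : ℝ → ℝ) (A₁ : ℝ → ℂ), ∀ q ∈ S,
    w.H q.1 q.2 =
      (A₀ q.2 + 2 * (A₁ q.2 * q.1).re + A₂ q.2 * Complex.normSq q.1)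
        / (1 + w.α * Complex.normSq q.1)

end WaveData

/-- `k = ∂_v` -/
def kField : Coord → Fin 4 → ℝ := fun _ => ![0, 0, 0, 1]

/-- The coordinate domain over a set `S` of pairs `(ζ, u)`; `v` is unrestricted. -/
def domainOver (S : Set (ℂ × ℝ)) : Set Coord := {x | (zetaOf x, uOf x) ∈ S}

end KundtWaves

end

open KundtWaves

/-! Put `W = Q/P` and `V = W_{,u}`. The metric is the surface metric `p (dx² + dy²)`, `p = 2/P²`, of
constant curvature `2α`, plus `W²` times `-2 du dv + (D v² - 2 (V/W) v - H/W) du²`. Everything rests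
on one property of `W`. Since `P` and `Q` are combinations of `1, ζ, ζ̄, ζζ̄` and `P` has no linear
term, the Hessian of `W` on the surface is pure trace, with factor `l = ε(α+β) - 2αW`; the same
holds for `V` with factor `-2αV`; and the squared gradient of `W` is a quadratic polynomial in `W`
with coefficients depending on `u`.

Consequently most curvature components vanish. The term of `F` linear in `v` is what removes `R₀₂₂₃`
and `R₁₂₂₃`: it makes `q_{,u} + F_{,v}` equal to `2 D W² v`. Six numbers remain (`curvForm`,
`riemann_warped`, `riemann_metric`). The Ricci tensor then has the same block shape as the metric,
which kills all `Φ` except `Φ₁₁` and `Φ₂₂`. The Weyl tensor is a `weylForm` with three parameters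
`ψ`, `S`, `t`. In `ψ = Ψ₂` the terms in `α` and in `ε(α+β)` cancel, leaving a multiple of `D - D₀`.
The pair `S - i t` is a multiple of `Ψ₄`, and it comes out as `(PH)_{,ζζ}` because the Hessian of
`P` is isotropic (`curvature_metric`).

The Petrov type is then algebra. The vector `k` is a principal null direction of multiplicity at
least two. A null direction transversal to `k` is labelled by a complex number `z`, and it is
principal when `S + i t = -3 p² ψ z²`. For `ψ ≠ 0` this gives two simple directions `±z` or one
double direction `z = 0`; for `ψ = 0` the vector `k` is quadruple or the Weyl tensor vanishes.

The table of types needs the real solutions of `f_{,ζζ} = 0` with `f = PH`: then `f_{,ζ̄}` is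
holomorphic with real derivative, hence affine on a connected slice, and `f` is a quadratic of the
form required by `IsH₀` (`exists_quadratic_of_dZeta_dZeta_eq_zero`). -/

namespace KundtWaves

open Filter Topology

/-! ### Tensors with curvature symmetries and six independent components -/

/-- The coordinate bivector `dxⁱ ∧ dxʲ`. -/
def wedge (i j a b : Fin 4) : ℝ :=
  (if a = i then 1 else 0) * (if b = j then 1 else 0)
    - (if a = j then 1 else 0) * (if b = i then 1 else 0)

/-- The curvature-like tensor whose only independent components are
`T₀₁₀₁ = c₁`, `T₂₃₂₃ = c₂`, `T₀₂₀₃ = T₁₂₁₃ = c₃`, `T₀₂₀₂ = s₁`, `T₁₂₁₂ = s₂`, `T₀₂₁₂ = t`. -/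
def curvForm (c₁ c₂ c₃ s₁ s₂ t : ℝ) (a b c d : Fin 4) : ℝ :=
  c₁ * (wedge 0 1 a b * wedge 0 1 c d) + c₂ * (wedge 2 3 a b * wedge 2 3 c d)
    + c₃ * (wedge 0 2 a b * wedge 0 3 c d + wedge 0 3 a b * wedge 0 2 c d
        + wedge 1 2 a b * wedge 1 3 c d + wedge 1 3 a b * wedge 1 2 c d)
    + s₁ * (wedge 0 2 a b * wedge 0 2 c d) + s₂ * (wedge 1 2 a b * wedge 1 2 c d)
    + t * (wedge 0 2 a b * wedge 1 2 c d + wedge 1 2 a b * wedge 0 2 c d)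

theorem wedge_swap (i j a b : Fin 4) : wedge i j b a = -wedge i j a b := by
  simp only [wedge]; ring

theorem curvForm_swap_left (c₁ c₂ c₃ s₁ s₂ t : ℝ) (a b c d : Fin 4) :
    curvForm c₁ c₂ c₃ s₁ s₂ t b a c d = -curvForm c₁ c₂ c₃ s₁ s₂ t a b c d := by
  simp only [curvForm, wedge_swap _ _ a b]; ring

theorem curvForm_pair (c₁ c₂ c₃ s₁ s₂ t : ℝ) (a b c d : Fin 4) :
    curvForm c₁ c₂ c₃ s₁ s₂ t c d a b = curvForm c₁ c₂ c₃ s₁ s₂ t a b c d := by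
  simp only [curvForm]; ring

/-- A tensor with the pair symmetries of a curvature tensor is determined by 21 components. -/
theorem eq_curvForm {T : Fin 4 → Fin 4 → Fin 4 → Fin 4 → ℝ} {c₁ c₂ c₃ s₁ s₂ t : ℝ}
    (hs : ∀ a b c d, T b a c d = -T a b c d) (hp : ∀ a b c d, T c d a b = T a b c d)
    (h0101 : T 0 1 0 1 = c₁) (h0102 : T 0 1 0 2 = 0) (h0103 : T 0 1 0 3 = 0)
    (h0112 : T 0 1 1 2 = 0) (h0113 : T 0 1 1 3 = 0) (h0123 : T 0 1 2 3 = 0)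
    (h0202 : T 0 2 0 2 = s₁) (h0203 : T 0 2 0 3 = c₃) (h0212 : T 0 2 1 2 = t)
    (h0213 : T 0 2 1 3 = 0) (h0223 : T 0 2 2 3 = 0) (h0303 : T 0 3 0 3 = 0)
    (h0312 : T 0 3 1 2 = 0) (h0313 : T 0 3 1 3 = 0) (h0323 : T 0 3 2 3 = 0)
    (h1212 : T 1 2 1 2 = s₂) (h1213 : T 1 2 1 3 = c₃) (h1223 : T 1 2 2 3 = 0)
    (h1313 : T 1 3 1 3 = 0) (h1323 : T 1 3 2 3 = 0) (h2323 : T 2 3 2 3 = c₂)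
    (a b c d : Fin 4) : T a b c d = curvForm c₁ c₂ c₃ s₁ s₂ t a b c d := by
  have key : ∀ a b c d, a < b → c < d → T a b c d = curvForm c₁ c₂ c₃ s₁ s₂ t a b c d := by
    -- Pair exchange reduces to lexicographically ordered index pairs, which leaves the 21 listed
    -- entries; the first Bianchi identity plays no role.
    have h3 : ∀ a b c d, a < b → c < d → (a < c ∨ a = c ∧ b ≤ d) →
        T a b c d = curvForm c₁ c₂ c₃ s₁ s₂ t a b c d := by
      intro a b c d h1 h2 h3
      fin_cases a <;> fin_cases b <;> try exact absurd h1 (by decide)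
      all_goals
        fin_cases c <;> fin_cases d <;> first
          | exact absurd h2 (by decide)
          | exact absurd h3 (by decide)
          | simp [curvForm, wedge, h0101, h0102, h0103, h0112, h0113, h0123, h0202, h0203, h0212,
              h0213, h0223, h0303, h0312, h0313, h0323, h1212, h1213, h1223, h1313, h1323, h2323]
    intro a b c d h1 h2
    by_cases h : a < c ∨ a = c ∧ b ≤ d
    · exact h3 a b c d h1 h2 h
    · rw [← hp, ← curvForm_pair]
      refine h3 c d a b h2 h1 ?_
      omega
  have key2 : ∀ a b c d, c < d → T a b c d = curvForm c₁ c₂ c₃ s₁ s₂ t a b c d := by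
    intro a b c d h
    rcases lt_trichotomy a b with h1 | h1 | h1
    · exact key a b c d h1 h
    · subst h1
      linarith [hs a a c d, curvForm_swap_left c₁ c₂ c₃ s₁ s₂ t a a c d]
    · rw [hs b a c d, curvForm_swap_left c₁ c₂ c₃ s₁ s₂ t b a c d, key b a c d h1 h]
  rw [← hp, ← curvForm_pair]
  rcases lt_trichotomy a b with h1 | h1 | h1
  · exact key2 c d a b h1
  · subst h1
    rw [hp, curvForm_pair]
    linarith [hs a a c d, curvForm_swap_left c₁ c₂ c₃ s₁ s₂ t a a c d]
  · have := key2 c d b a h1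
    rw [hp, curvForm_pair] at *
    rw [hs b a c d, curvForm_swap_left c₁ c₂ c₃ s₁ s₂ t b a c d, this]

/-! ### Block metrics: Ricci and Weyl tensors at a point -/

/-- The shape of the metric: `p ((dx⁰)² + (dx¹)²) + F (dx²)² - 2 q dx² dx³`. -/
def block (p q F : ℝ) : Matrix (Fin 4) (Fin 4) ℝ :=
  !![p, 0, 0, 0; 0, p, 0, 0; 0, 0, F, -q; 0, 0, -q, 0]

/-- The inverse of `block p q F`. -/
noncomputable def blockInv (p q F : ℝ) : Matrix (Fin 4) (Fin 4) ℝ :=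
  !![p⁻¹, 0, 0, 0; 0, p⁻¹, 0, 0; 0, 0, 0, -q⁻¹; 0, 0, -q⁻¹, -(F * (q ^ 2)⁻¹)]

theorem block_mul_blockInv {p q F : ℝ} (hp : p ≠ 0) (hq : q ≠ 0) :
    block p q F * blockInv p q F = 1 := by
  ext i j
  fin_cases i <;> fin_cases j <;>
    simp [block, blockInv, Matrix.mul_apply, Fin.sum_univ_four, hp, hq]
  field_simp; ring

theorem block_inv {p q F : ℝ} (hp : p ≠ 0) (hq : q ≠ 0) :
    (block p q F)⁻¹ = blockInv p q F :=
  Matrix.inv_eq_right_inv (block_mul_blockInv hp hq)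

/-- The Weyl tensor with `Ψ₂ = ψ`, the other free components being `S` and `t`. -/
def weylForm (p q F ψ S t : ℝ) : Fin 4 → Fin 4 → Fin 4 → Fin 4 → ℝ :=
  curvForm (-2 * p ^ 2 * ψ) (2 * q ^ 2 * ψ) (-(p * q * ψ)) (p * F * ψ + S) (p * F * ψ - S) t

section Pointwise

variable {g : MetricField} {x : Coord} {p q F c₁ c₂ c₃ s₁ s₂ t : ℝ}

/-- The trace of a `curvForm` over a block metric is again a block matrix. This is the source of all
vanishing `Φ` scalars. -/
theorem ricci_of_block (hp : p ≠ 0) (hq : q ≠ 0) (hg : g x = block p q F)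
    (hR : ∀ a b c d, riemann g x a b c d = curvForm c₁ c₂ c₃ s₁ s₂ t a b c d)
    (hr : ∀ b d, ricci g x b d = ∑ a, ∑ e, (g x)⁻¹ a e * riemann g x e b a d)
    (b d : Fin 4) :
    ricci g x b d = block (c₁ / p - 2 * c₃ / q) (-(2 * c₃ / p + c₂ / q))
      ((s₁ + s₂) / p - F * c₂ / q ^ 2) b d := by
  simp only [hr, hR, hg, block_inv hp hq]
  fin_cases b <;> fin_cases d <;>
    simp [Fin.sum_univ_four, blockInv, block, curvForm, wedge] <;> field_simp <;> ring

theorem scalarCurv_of_block (hp : p ≠ 0) (hq : q ≠ 0) (hg : g x = block p q F)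
    (hr : ∀ b d, ricci g x b d = block (c₁ / p - 2 * c₃ / q) (-(2 * c₃ / p + c₂ / q))
      ((s₁ + s₂) / p - F * c₂ / q ^ 2) b d) :
    scalarCurv g x = 2 * c₁ / p ^ 2 - 8 * c₃ / (p * q) - 2 * c₂ / q ^ 2 := by
  simp only [scalarCurv, hr, hg, block_inv hp hq]
  simp [Fin.sum_univ_four, blockInv, block]
  field_simp
  ring

theorem traceFreeRicci_of_block {r₀ r₁ r₂ : ℝ} (hg : g x = block p q F)
    (hr : ∀ b d, ricci g x b d = block r₀ r₁ r₂ b d) :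
    traceFreeRicci g x = block (r₀ - scalarCurv g x / 4 * p) (r₁ - scalarCurv g x / 4 * q)
      (r₂ - scalarCurv g x / 4 * F) := by
  funext i j
  rw [traceFreeRicci, hr, hg]
  fin_cases i <;> fin_cases j <;> simp [block]
  all_goals ring

theorem weyl_swap (hs : ∀ a b c d, riemann g x b a c d = -riemann g x a b c d) (a b c d : Fin 4) :
    weyl g x b a c d = -weyl g x a b c d := by
  simp only [weyl, hs a b c d]; ring

/-- Removing traces leaves one combination of `c₁, c₂, c₃` (the value of `Ψ₂`), half the difference
of `s₁` and `s₂`, and `t`; the sum `s₁ + s₂` belongs to the Ricci tensor. -/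
theorem weyl_of_block (hp : p ≠ 0) (hq : q ≠ 0) (hg : g x = block p q F)
    (hR : ∀ a b c d, riemann g x a b c d = curvForm c₁ c₂ c₃ s₁ s₂ t a b c d)
    (hr : ∀ b d, ricci g x b d = block (c₁ / p - 2 * c₃ / q) (-(2 * c₃ / p + c₂ / q))
      ((s₁ + s₂) / p - F * c₂ / q ^ 2) b d)
    (a b c d : Fin 4) :
    weyl g x a b c d = weylForm p q F
      (-c₁ / (6 * p ^ 2) - c₃ / (3 * p * q) + c₂ / (6 * q ^ 2)) ((s₁ - s₂) / 2) t a b c d := by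
  have hsym : ∀ i j, g x i j = g x j i := by
    intro i j; rw [hg]; fin_cases i <;> fin_cases j <;> rfl
  have hrsym : ∀ i j, ricci g x i j = ricci g x j i := by
    intro i j; rw [hr, hr]; fin_cases i <;> fin_cases j <;> rfl
  refine eq_curvForm (fun a b c d => weyl_swap (fun a b c d => ?_) a b c d) (fun a b c d => ?_)
    ?_ ?_ ?_ ?_ ?_ ?_ ?_ ?_ ?_ ?_ ?_ ?_ ?_ ?_ ?_ ?_ ?_ ?_ ?_ ?_ ?_ a b c d
  · rw [hR, hR, curvForm_swap_left]
  · simp only [weyl, hR, curvForm_pair c₁ c₂ c₃ s₁ s₂ t a b c d]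
    rw [hsym c a, hsym d b, hsym c b, hsym d a, hrsym d b, hrsym c a, hrsym d a, hrsym c b]
    ring
  all_goals
    simp only [weyl, hR, hr, hg, scalarCurv_of_block hp hq hg hr]
    simp [block, curvForm, wedge]
  all_goals field_simp
  all_goals ring

end Pointwise

/-! ### Contractions of curvature forms with complex vectors -/

/-- The contraction of `dxⁱ ∧ dxʲ` with two complex vectors. -/
def cwedge (i j : Fin 4) (X Y : Fin 4 → ℂ) : ℂ := X i * Y j - X j * Y i

/-- A decomposable tensor contracts to a product of two `2 × 2` minors, so that the scalars `Ψᵢ` can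
be evaluated without expanding 256 terms. -/
theorem contract4_wedge (i j k l : Fin 4) (X Y Z W : Fin 4 → ℂ) :
    contract4 (fun a b c d => wedge i j a b * wedge k l c d) X Y Z W
      = cwedge i j X Y * cwedge k l Z W := by
  have h : ∀ (i j : Fin 4) (X Y : Fin 4 → ℂ),
      cwedge i j X Y = ∑ a, ∑ b, (wedge i j a b : ℂ) * X a * Y b := by
    intro i j X Y
    fin_cases i <;> fin_cases j <;> simp [Fin.sum_univ_four, wedge, cwedge] <;> ring
  rw [h, h]
  simp only [Finset.sum_mul]
  simp only [Finset.mul_sum, contract4]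
  refine Finset.sum_congr rfl fun a _ => Finset.sum_congr rfl fun b _ =>
    Finset.sum_congr rfl fun c _ => Finset.sum_congr rfl fun d _ => ?_
  push_cast
  ring

theorem contract4_add (T T' : Fin 4 → Fin 4 → Fin 4 → Fin 4 → ℝ) (X Y Z W : Fin 4 → ℂ) :
    contract4 (fun a b c d => T a b c d + T' a b c d) X Y Z W
      = contract4 T X Y Z W + contract4 T' X Y Z W := by
  simp only [contract4, ← Finset.sum_add_distrib]
  push_cast
  simp only [add_mul]

theorem contract4_smul (r : ℝ) (T : Fin 4 → Fin 4 → Fin 4 → Fin 4 → ℝ) (X Y Z W : Fin 4 → ℂ) :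
    contract4 (fun a b c d => r * T a b c d) X Y Z W = r * contract4 T X Y Z W := by
  simp only [contract4, Finset.mul_sum]
  push_cast
  simp only [mul_assoc]

theorem contract4_curvForm (c₁ c₂ c₃ s₁ s₂ t : ℝ) (X Y Z W : Fin 4 → ℂ) :
    contract4 (curvForm c₁ c₂ c₃ s₁ s₂ t) X Y Z W =
      c₁ * (cwedge 0 1 X Y * cwedge 0 1 Z W) + c₂ * (cwedge 2 3 X Y * cwedge 2 3 Z W)
      + c₃ * (cwedge 0 2 X Y * cwedge 0 3 Z W + cwedge 0 3 X Y * cwedge 0 2 Z W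
        + cwedge 1 2 X Y * cwedge 1 3 Z W + cwedge 1 3 X Y * cwedge 1 2 Z W)
      + s₁ * (cwedge 0 2 X Y * cwedge 0 2 Z W) + s₂ * (cwedge 1 2 X Y * cwedge 1 2 Z W)
      + t * (cwedge 0 2 X Y * cwedge 1 2 Z W + cwedge 1 2 X Y * cwedge 0 2 Z W) := by
  simp only [← contract4_wedge, ← contract4_add, ← contract4_smul]
  rfl

/-! ### Principal null directions and Petrov types of `weylForm` -/

section Petrov

variable {p q F ψ S t : ℝ}

theorem weylForm_eq_zero_iff (hp : p ≠ 0) (hq : q ≠ 0) :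
    (∀ a b c d, weylForm p q F ψ S t a b c d = 0) ↔ ψ = 0 ∧ S = 0 ∧ t = 0 := by
  constructor
  · intro h
    have h1 := h 0 2 0 3
    have h2 := h 0 2 0 2
    have h3 := h 0 2 1 2
    simp [weylForm, curvForm, wedge] at h1 h2 h3
    have hψ : ψ = 0 := by tauto
    subst hψ
    exact ⟨rfl, by linarith, h3⟩
  · rintro ⟨rfl, rfl, rfl⟩ a b c d
    simp [weylForm, curvForm]

theorem hasPetrovType_O_iff (hp : p ≠ 0) (hq : q ≠ 0) :
    HasPetrovType (block p q F) (weylForm p q F ψ S t) .O ↔ ψ = 0 ∧ S = 0 ∧ t = 0 :=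
  weylForm_eq_zero_iff hp hq

theorem pnd_k_two : PNDMultiplicityGE (block p q F) (weylForm p q F ψ S t) ![0, 0, 0, 1] 2 := by
  intro a d f
  fin_cases a <;> fin_cases d <;> fin_cases f <;>
    simp [Fin.sum_univ_four, block, weylForm, curvForm, wedge]

theorem isPND_k_two (hp : p ≠ 0) (hq : q ≠ 0) (hψ : ψ ≠ 0) :
    IsPND (block p q F) (weylForm p q F ψ S t) ![0, 0, 0, 1] 2 := by
  refine ⟨fun h => by simpa using congrFun h 3, ?_, pnd_k_two, fun h => ?_⟩
  · simp [bilin, Fin.sum_univ_four, block]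
  -- This entry of the threefold criterion is a non-zero multiple of `p q² ψ`.
  · have := h 0 2 0 2
    simp [Fin.sum_univ_four, block, weylForm, curvForm, wedge] at this
    tauto

theorem isPND_k_four : IsPND (block p q F) (weylForm p q F 0 S t) ![0, 0, 0, 1] 4 := by
  -- The criterion with `n = 5` is `False` by definition, so multiplicity exactly four needs no
  -- further argument.
  refine ⟨fun h => by simpa using congrFun h 3, ?_, ?_, fun h => h⟩
  · simp [bilin, Fin.sum_univ_four, block]
  · intro a b d
    simp [Fin.sum_univ_four, weylForm, curvForm, wedge]

theorem hasPetrovType_N (hp : p ≠ 0) (hq : q ≠ 0) (h : ¬ (S = 0 ∧ t = 0)) :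
    HasPetrovType (block p q F) (weylForm p q F 0 S t) .N := by
  refine ⟨?_, _, isPND_k_four⟩
  by_contra! hC
  exact h ((weylForm_eq_zero_iff hp hq).1 hC).2

/-- The null vector with screen components `(x₀, x₁)`, transversal to `∂_v`. -/
noncomputable def nullVec (p q F x₀ x₁ : ℝ) : Fin 4 → ℝ :=
  ![x₀, x₁, 1, (F + p * (x₀ ^ 2 + x₁ ^ 2)) / (2 * q)]

theorem nullVec_ne_zero (x₀ x₁ : ℝ) : nullVec p q F x₀ x₁ ≠ 0 :=
  fun h => by simpa [nullVec] using congrFun h 2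

theorem nullVec_null (hq : q ≠ 0) (x₀ x₁ : ℝ) :
    bilin (block p q F) (nullVec p q F x₀ x₁) (nullVec p q F x₀ x₁) = 0 := by
  simp [bilin, Fin.sum_univ_four, block, nullVec]
  field_simp
  ring

theorem distinctDir_k_nullVec (x₀ x₁ : ℝ) :
    DistinctDir ![0, 0, 0, 1] (nullVec p q F x₀ x₁) := by
  refine LinearIndependent.pair_iff.2 fun s r h => ?_
  have h2 := congrFun h 2
  have h3 := congrFun h 3
  simp [nullVec] at h2 h3
  subst h2
  simpa using h3

theorem distinctDir_nullVec {x₀ x₁ y₀ y₁ : ℝ} (h : x₀ ≠ y₀ ∨ x₁ ≠ y₁) :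
    DistinctDir (nullVec p q F x₀ x₁) (nullVec p q F y₀ y₁) := by
  refine LinearIndependent.pair_iff.2 fun s r hsr => ?_
  have h0 := congrFun hsr 0
  have h1 := congrFun hsr 1
  have h2 := congrFun hsr 2
  simp [nullVec] at h0 h1 h2
  obtain rfl : r = -s := by linarith
  have : s = 0 := by
    rcases h with h | h
    · have : s * (x₀ - y₀) = 0 := by linarith
      exact (mul_eq_zero.1 this).resolve_right (sub_ne_zero.2 h)
    · have : s * (x₁ - y₁) = 0 := by linarith
      exact (mul_eq_zero.1 this).resolve_right (sub_ne_zero.2 h)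
  simp [this]

/-- A symmetric tensor of the form `k ⊗ w + w ⊗ k` satisfies the criterion for a principal null
direction. -/
theorem antisymm_of_eq_sym_prod {T : Fin 4 → Fin 4 → ℝ} {k w : Fin 4 → ℝ}
    (h : ∀ a d, T a d = k a * w d + w a * k d) (e a d f : Fin 4) :
    k e * T a d * k f - k a * T e d * k f - k e * T a f * k d + k a * T e f * k d = 0 := by
  simp only [h]; ring

/-- The hypotheses on `S` and `t` are the real and imaginary parts of `S + i t = -3 p² ψ z²` with `z
= x₀ + i x₁`. Under this equation the contraction of the Weyl tensor with the null vector is a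
symmetrized product with the lowered vector as one factor, as the simple Bel–Debever criterion
requires. The other factor is written out explicitly because its direction decides whether the
multiplicity is one or two. -/
theorem weylForm_nullVec (hp : p ≠ 0) (hq : q ≠ 0) {x₀ x₁ : ℝ}
    (hS : S = -(3 * p ^ 2 * ψ * (x₀ ^ 2 - x₁ ^ 2)))
    (ht : t = -(6 * p ^ 2 * ψ * (x₀ * x₁))) (a d : Fin 4) :
    ∑ b, ∑ c, weylForm p q F ψ S t a b c d * nullVec p q F x₀ x₁ b * nullVec p q F x₀ x₁ c
      = (∑ b, block p q F a b * nullVec p q F x₀ x₁ b)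
          * ![2 * p * ψ * x₀, 2 * p * ψ * x₁, -(ψ / 2 * (F + 5 * p * (x₀ ^ 2 + x₁ ^ 2))), q * ψ] d
        + ![2 * p * ψ * x₀, 2 * p * ψ * x₁, -(ψ / 2 * (F + 5 * p * (x₀ ^ 2 + x₁ ^ 2))), q * ψ] a
          * ∑ b, block p q F d b * nullVec p q F x₀ x₁ b := by
  subst hS ht
  fin_cases a <;> fin_cases d <;>
    simp [Fin.sum_univ_four, block, weylForm, curvForm, wedge, nullVec] <;> field_simp <;>
    ring

theorem isPND_l_two (hp : p ≠ 0) (hq : q ≠ 0) (hψ : ψ ≠ 0) :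
    IsPND (block p q F) (weylForm p q F ψ 0 0) (nullVec p q F 0 0) 2 := by
  refine ⟨nullVec_ne_zero 0 0, nullVec_null hq 0 0, ?_, fun h => ?_⟩
  -- At `z = 0` the second factor is `-ψ` times the lowered null vector, so the contraction is a
  -- multiple of its square and the multiplicity rises to two.
  · have hw : ∀ a, (![2 * p * ψ * 0, 2 * p * ψ * 0, -(ψ / 2 * (F + 5 * p * (0 ^ 2 + 0 ^ 2))),
        q * ψ] : Fin 4 → ℝ) a = -ψ * ∑ b, block p q F a b * nullVec p q F 0 0 b := by
      intro a
      fin_cases a <;> simp [Fin.sum_univ_four, block, nullVec] <;> field_simp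
      ring
    intro a d f
    dsimp only
    rw [weylForm_nullVec hp hq (by ring) (by ring), weylForm_nullVec hp hq (by ring) (by ring),
      hw, hw, hw]
    ring
  · have := h 0 3 0 3
    simp [Fin.sum_univ_four, block, weylForm, curvForm, wedge, nullVec] at this
    tauto

theorem hasPetrovType_D (hp : p ≠ 0) (hq : q ≠ 0) (hψ : ψ ≠ 0) :
    HasPetrovType (block p q F) (weylForm p q F ψ 0 0) .D := by
  refine ⟨?_, _, _, distinctDir_k_nullVec 0 0, isPND_k_two hp hq hψ, isPND_l_two hp hq hψ⟩
  by_contra! hC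
  exact hψ ((weylForm_eq_zero_iff hp hq).1 hC).1

theorem isPND_nullVec_one (hp : p ≠ 0) (hq : q ≠ 0) (hψ : ψ ≠ 0) {x₀ x₁ : ℝ}
    (hx : x₀ ≠ 0 ∨ x₁ ≠ 0) (hS : S = -(3 * p ^ 2 * ψ * (x₀ ^ 2 - x₁ ^ 2)))
    (ht : t = -(6 * p ^ 2 * ψ * (x₀ * x₁))) :
    IsPND (block p q F) (weylForm p q F ψ S t) (nullVec p q F x₀ x₁) 1 := by
  refine ⟨nullVec_ne_zero _ _, nullVec_null hq _ _, ?_, fun h => ?_⟩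
  · exact antisymm_of_eq_sym_prod (weylForm_nullVec hp hq hS ht)
  -- For `z ≠ 0` the two factors are not proportional; a non-zero screen component of the null
  -- vector exposes this in one entry of the double criterion.
  · rcases hx with hx | hx
    · have := h 3 3 0
      simp [Fin.sum_univ_four, block, weylForm, curvForm, wedge, nullVec] at this
      have h2 : p * q ^ 2 * ψ * x₀ = 0 := by linarith
      simp_all
    · have := h 3 3 1
      simp [Fin.sum_univ_four, block, weylForm, curvForm, wedge, nullVec] at this
      have h2 : p * q ^ 2 * ψ * x₁ = 0 := by linarith
      simp_all

theorem hasPetrovType_II (hp : p ≠ 0) (hq : q ≠ 0) (hψ : ψ ≠ 0) (h : ¬ (S = 0 ∧ t = 0)) :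
    HasPetrovType (block p q F) (weylForm p q F ψ S t) .II := by
  -- The simple principal directions are the two square roots `±z`; they differ because `S + i t ≠
  -- 0`.
  obtain ⟨z, hz⟩ := IsAlgClosed.exists_pow_nat_eq (-(⟨S, t⟩ : ℂ) / (3 * p ^ 2 * ψ : ℝ)) two_pos
  have hz' : z ^ 2 * (3 * p ^ 2 * ψ : ℝ) = -(⟨S, t⟩ : ℂ) := by
    rw [hz, div_mul_cancel₀]
    exact Complex.ofReal_ne_zero.2 (by positivity)
  have hS : S = -(3 * p ^ 2 * ψ * (z.re ^ 2 - z.im ^ 2)) := by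
    have := congrArg Complex.re hz'
    simp [sq] at this
    linarith
  have ht : t = -(6 * p ^ 2 * ψ * (z.re * z.im)) := by
    have := congrArg Complex.im hz'
    simp [sq] at this
    linarith
  have hz0 : z.re ≠ 0 ∨ z.im ≠ 0 := by
    by_contra! h0
    exact h ⟨by rw [hS, h0.1, h0.2]; ring, by rw [ht, h0.1]; ring⟩
  refine ⟨?_, _, _, _, distinctDir_k_nullVec z.re z.im, distinctDir_k_nullVec (-z.re) (-z.im),
    distinctDir_nullVec ?_, isPND_k_two hp hq hψ, isPND_nullVec_one hp hq hψ hz0 hS ht,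
    isPND_nullVec_one hp hq hψ ?_ (by rw [hS]; ring) (by rw [ht]; ring)⟩
  · by_contra! hC
    exact hψ ((weylForm_eq_zero_iff hp hq).1 hC).1
  · exact hz0.imp (fun h => self_eq_neg.not.2 h) (fun h => self_eq_neg.not.2 h)
  · exact hz0.imp neg_ne_zero.2 neg_ne_zero.2

end Petrov

/-! ### Coordinate partial derivatives -/

section PartialDerivatives

variable {f h : Coord → ℝ} {x : Coord}

theorem pderiv_add (hf : DifferentiableAt ℝ f x) (hh : DifferentiableAt ℝ h x) (i : Fin 4) :
    pderiv i (fun y => f y + h y) x = pderiv i f x + pderiv i h x := by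
  simp [pderiv, fderiv_fun_add hf hh]

theorem pderiv_sub (hf : DifferentiableAt ℝ f x) (hh : DifferentiableAt ℝ h x) (i : Fin 4) :
    pderiv i (fun y => f y - h y) x = pderiv i f x - pderiv i h x := by
  simp [pderiv, fderiv_fun_sub hf hh]

theorem pderiv_mul (hf : DifferentiableAt ℝ f x) (hh : DifferentiableAt ℝ h x) (i : Fin 4) :
    pderiv i (fun y => f y * h y) x = pderiv i f x * h x + f x * pderiv i h x := by
  simp [pderiv, fderiv_fun_mul hf hh]
  ring

theorem pderiv_const_mul (c : ℝ) (hf : DifferentiableAt ℝ f x) (i : Fin 4) :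
    pderiv i (fun y => c * f y) x = c * pderiv i f x := by
  simp [pderiv, fderiv_const_mul hf]

theorem pderiv_sum {ι : Type*} {s : Finset ι} {f : ι → Coord → ℝ}
    (hf : ∀ j ∈ s, DifferentiableAt ℝ (f j) x) (i : Fin 4) :
    pderiv i (fun y => ∑ j ∈ s, f j y) x = ∑ j ∈ s, pderiv i (f j) x := by
  simp [pderiv, fderiv_fun_sum hf]

theorem pderiv_congr (hfh : f =ᶠ[𝓝 x] h) (i : Fin 4) : pderiv i f x = pderiv i h x := by
  simp [pderiv, hfh.fderiv_eq]

theorem pderiv_eventuallyEq (hfh : f =ᶠ[𝓝 x] h) (i : Fin 4) :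
    pderiv i f =ᶠ[𝓝 x] pderiv i h :=
  hfh.eventuallyEq_nhds.mono fun _ hy => pderiv_congr hy i

theorem contDiffAt_pderiv {n : WithTop ℕ∞} (hf : ContDiffAt ℝ (n + 1) f x) (i : Fin 4) :
    ContDiffAt ℝ n (pderiv i f) x :=
  (hf.fderiv_right le_rfl).clm_apply contDiffAt_const

theorem differentiableAt_pderiv (hf : ContDiffAt ℝ 2 f x) (i : Fin 4) :
    DifferentiableAt ℝ (pderiv i f) x :=
  (contDiffAt_pderiv (n := 1) (by simpa [one_add_one_eq_two] using hf) i).differentiableAt (by simp)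

theorem pderiv_pderiv_eq (hf : ContDiffAt ℝ 2 f x) (i j : Fin 4) :
    pderiv i (pderiv j f) x = fderiv ℝ (fderiv ℝ f) x (Pi.single i 1) (Pi.single j 1) := by
  have : DifferentiableAt ℝ (fderiv ℝ f) x :=
    (hf.fderiv_right (m := 1) (by norm_num)).differentiableAt (by simp)
  change fderiv ℝ (fun y => fderiv ℝ f y (Pi.single j 1)) x (Pi.single i 1) = _
  rw [fderiv_clm_apply this (differentiableAt_const _)]
  simp

theorem pderiv_comm (hf : ContDiffAt ℝ 2 f x) (i j : Fin 4) :
    pderiv i (pderiv j f) x = pderiv j (pderiv i f) x := by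
  rw [pderiv_pderiv_eq hf, pderiv_pderiv_eq hf]
  exact hf.isSymmSndFDerivAt (by simp) _ _

end PartialDerivatives

/-! ### The curvature tensor from the two-jet of the metric -/

/-- Christoffel symbols of the first kind in terms of the first derivatives `dg k i j = ∂_k g_ij`. -/
noncomputable def christoffelLower (dg : Fin 4 → Fin 4 → Fin 4 → ℝ) (a b c : Fin 4) : ℝ :=
  (1 / 2) * (dg b a c + dg c a b - dg a b c)

/-- The covariant curvature tensor in terms of the inverse metric `gi` and the first and second
derivatives of the metric. -/
noncomputable def curvatureOfJet (gi : Matrix (Fin 4) (Fin 4) ℝ) (dg : Fin 4 → Fin 4 → Fin 4 → ℝ)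
    (ddg : Fin 4 → Fin 4 → Fin 4 → Fin 4 → ℝ) (a b c d : Fin 4) : ℝ :=
  (1 / 2) * (ddg c b a d - ddg c a b d - ddg d b a c + ddg d a b c)
    + ∑ e, ∑ f, gi e f * (christoffelLower dg e a d * christoffelLower dg f b c
      - christoffelLower dg e a c * christoffelLower dg f b d)

theorem curvatureOfJet_swap (gi : Matrix (Fin 4) (Fin 4) ℝ) {dg : Fin 4 → Fin 4 → Fin 4 → ℝ}
    {ddg : Fin 4 → Fin 4 → Fin 4 → Fin 4 → ℝ} (hgi : ∀ i j, gi i j = gi j i) (a b c d : Fin 4) :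
    curvatureOfJet gi dg ddg b a c d = -curvatureOfJet gi dg ddg a b c d := by
  have h : ∀ X Y : Fin 4 → ℝ, ∑ e, ∑ f, gi e f * (X e * Y f) = ∑ e, ∑ f, gi e f * (Y e * X f) := by
    intro X Y
    rw [Finset.sum_comm]
    refine Finset.sum_congr rfl fun e _ => Finset.sum_congr rfl fun f _ => ?_
    rw [hgi]; ring
  simp only [curvatureOfJet, mul_sub, Finset.sum_sub_distrib]
  rw [h (fun e => christoffelLower dg e b d), h (fun e => christoffelLower dg e b c)]
  ring

theorem curvatureOfJet_pair {gi : Matrix (Fin 4) (Fin 4) ℝ} {dg : Fin 4 → Fin 4 → Fin 4 → ℝ}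
    {ddg : Fin 4 → Fin 4 → Fin 4 → Fin 4 → ℝ} (hgi : ∀ i j, gi i j = gi j i)
    (hdg : ∀ k i j, dg k i j = dg k j i) (hddg : ∀ k l i j, ddg k l i j = ddg k l j i)
    (hddg' : ∀ k l i j, ddg k l i j = ddg l k i j) (a b c d : Fin 4) :
    curvatureOfJet gi dg ddg c d a b = curvatureOfJet gi dg ddg a b c d := by
  have h : ∀ X Y : Fin 4 → ℝ, ∑ e, ∑ f, gi e f * (X e * Y f) = ∑ e, ∑ f, gi e f * (Y e * X f) := by
    intro X Y
    rw [Finset.sum_comm]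
    refine Finset.sum_congr rfl fun e _ => Finset.sum_congr rfl fun f _ => ?_
    rw [hgi]; ring
  have hG : ∀ a b c, christoffelLower dg a c b = christoffelLower dg a b c := by
    intro a b c
    simp only [christoffelLower, hdg a c b]; ring
  simp only [curvatureOfJet, mul_sub, Finset.sum_sub_distrib]
  rw [h (fun e => christoffelLower dg e c b)]
  simp only [hG _ b c, hG _ a d, hG _ a c, hG _ b d]
  rw [hddg a d c b, hddg' a d b c, hddg' a c d b, hddg c a d b, hddg b d c a, hddg' b d a c,
    hddg b c d a, hddg' b c a d]
  ring

/-- `gi` is a differentiable inverse of the symmetric metric `g` of class `C²` near `x`. -/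
structure IsMetricInverse (g gi : MetricField) (x : Coord) : Prop where
  smooth : ∀ i j, ContDiffAt ℝ 2 (fun y => g y i j) x
  symm : ∀ᶠ y in 𝓝 x, ∀ i j, g y i j = g y j i
  mul_eq_one : ∀ᶠ y in 𝓝 x, g y * gi y = 1
  differentiable : ∀ i j, DifferentiableAt ℝ (fun y => gi y i j) x

namespace IsMetricInverse

variable {g gi : MetricField} {x : Coord} (h : IsMetricInverse g gi x)

include h

theorem inv_eq : ∀ᶠ y in 𝓝 x, (g y)⁻¹ = gi y :=
  h.mul_eq_one.mono fun _ hy => Matrix.inv_eq_right_inv hy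

theorem pderiv_christoffelLower (a b c k : Fin 4) :
    DifferentiableAt ℝ (fun y => christoffelLower (fun k i j => pderiv k (fun z => g z i j) y)
        a b c) x ∧
    pderiv k (fun y => christoffelLower (fun k i j => pderiv k (fun z => g z i j) y) a b c) x =
      (1 / 2) * (pderiv k (pderiv b fun z => g z a c) x + pderiv k (pderiv c fun z => g z a b) x
        - pderiv k (pderiv a fun z => g z b c) x) := by
  have hd : ∀ i j k, DifferentiableAt ℝ (pderiv k fun z => g z i j) x :=
    fun i j k => differentiableAt_pderiv (h.smooth i j) k
  have h1 := (hd a c b).add (hd a b c)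
  have h2 := h1.sub (hd b c a)
  refine ⟨h2.const_mul _, ?_⟩
  have := pderiv_const_mul (1 / 2) h2 k
  refine this.trans ?_
  congr 1
  refine (pderiv_sub h1 (hd b c a) k).trans ?_
  congr 1
  exact pderiv_add (hd a c b) (hd a b c) k

theorem christoffel_eq : ∀ᶠ y in 𝓝 x, ∀ a b c, christoffel g y a b c = ∑ d, gi y a d *
    christoffelLower (fun k i j => pderiv k (fun z => g z i j) y) d b c := by
  filter_upwards [h.inv_eq] with y hy a b c
  simp only [christoffel, hy, christoffelLower]
  exact Finset.sum_congr rfl fun d _ => by ring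

theorem differentiableAt_christoffel (a b c : Fin 4) :
    DifferentiableAt ℝ (fun y => christoffel g y a b c) x := by
  have h1 : (fun y => christoffel g y a b c) =ᶠ[𝓝 x] fun y => ∑ d, gi y a d *
      christoffelLower (fun k i j => pderiv k (fun z => g z i j) y) d b c :=
    h.christoffel_eq.mono fun y hy => hy a b c
  rw [h1.differentiableAt_iff]
  exact DifferentiableAt.fun_sum fun d _ =>
    (h.differentiable a d).mul (h.pderiv_christoffelLower d b c 0).1

theorem sum_mul_christoffel : ∀ᶠ y in 𝓝 x, ∀ a b c, ∑ e, g y a e * christoffel g y e b c =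
    christoffelLower (fun k i j => pderiv k (fun z => g z i j) y) a b c := by
  filter_upwards [h.mul_eq_one, h.christoffel_eq] with y hy hc a b c
  simp only [hc, Finset.mul_sum]
  rw [Finset.sum_comm]
  simp only [← mul_assoc, ← Finset.sum_mul]
  have : ∀ d, ∑ e, g y a e * gi y e d = if a = d then 1 else 0 := by
    intro d
    rw [← Matrix.mul_apply, hy, Matrix.one_apply]
  simp [this]

/-- Differentiating the relation `g_{ae} Γ^e_{bd} = Γ_{a,bd}` avoids derivatives of the inverse
metric in the final formula. Metric compatibility `∂_c g_{ae} = Γ_{a,ce} + Γ_{e,ac}` splits the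
product-rule term: the first half cancels against the quadratic part of the curvature tensor, the
second half survives. -/
theorem riemann_eq (a b c d : Fin 4) :
    riemann g x a b c d = curvatureOfJet (gi x) (fun k i j => pderiv k (fun z => g z i j) x)
      (fun k l i j => pderiv k (pderiv l fun z => g z i j) x) a b c d := by
  set dg : Fin 4 → Fin 4 → Fin 4 → ℝ := fun k i j => pderiv k (fun z => g z i j) x with hdg
  set ddg : Fin 4 → Fin 4 → Fin 4 → Fin 4 → ℝ :=
    fun k l i j => pderiv k (pderiv l fun z => g z i j) x with hddg
  have hsymm : ∀ i j, (fun z => g z i j) =ᶠ[𝓝 x] fun z => g z j i :=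
    fun i j => h.symm.mono fun y hy => hy i j
  have hdgs : ∀ k i j, dg k i j = dg k j i := fun k i j => pderiv_congr (hsymm i j) k
  have hddgs : ∀ k l i j, ddg k l i j = ddg k l j i :=
    fun k l i j => pderiv_congr (pderiv_eventuallyEq (hsymm i j) l) k
  have hddgc : ∀ k l i j, ddg k l i j = ddg l k i j :=
    fun k l i j => pderiv_comm (h.smooth i j) k l
  have hprod : ∀ a b d c, (1 / 2) * (ddg c b a d + ddg c d a b - ddg c a b d) =
      ∑ e, (dg c a e * christoffel g x e b d
        + g x a e * pderiv c (fun y => christoffel g y e b d) x) := by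
    intro a b d c
    rw [← (h.pderiv_christoffelLower a b d c).2,
      ← pderiv_congr (h.sum_mul_christoffel.mono fun y hy => hy a b d) c, pderiv_sum]
    · refine Finset.sum_congr rfl fun e _ => ?_
      exact pderiv_mul ((h.smooth a e).differentiableAt (by simp))
        (h.differentiableAt_christoffel e b d) c
    · exact fun e _ => ((h.smooth a e).differentiableAt (by simp)).mul
        (h.differentiableAt_christoffel e b d)
  have hdgL : ∀ c a e, dg c a e = christoffelLower dg a c e + christoffelLower dg e a c := by
    intro c a e
    simp only [christoffelLower, hdgs c e a, hdgs e a c, hdgs a e c]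
    ring
  have hlow := h.sum_mul_christoffel.self_of_nhds
  have hup := h.christoffel_eq.self_of_nhds
  have hquad :
      ∑ e, g x a e * ∑ f, (christoffel g x e c f * christoffel g x f b d
        - christoffel g x e d f * christoffel g x f b c) =
      ∑ f, (christoffelLower dg a c f * christoffel g x f b d
        - christoffelLower dg a d f * christoffel g x f b c) := by
    simp only [Finset.mul_sum]
    rw [Finset.sum_comm]
    refine Finset.sum_congr rfl fun f _ => ?_
    rw [← hlow a c f, ← hlow a d f, Finset.sum_mul, Finset.sum_mul, ← Finset.sum_sub_distrib]
    exact Finset.sum_congr rfl fun e _ => by ring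
  have hsplit : riemann g x a b c d =
      (∑ e, g x a e * pderiv c (fun y => christoffel g y e b d) x)
      - (∑ e, g x a e * pderiv d (fun y => christoffel g y e b c) x)
      + ∑ f, (christoffelLower dg a c f * christoffel g x f b d
        - christoffelLower dg a d f * christoffel g x f b c) := by
    rw [← hquad, ← Finset.sum_sub_distrib, ← Finset.sum_add_distrib]
    exact Finset.sum_congr rfl fun e _ => by simp only [riemannUp]; ring
  have h1 := hprod a b d c
  have h2 := hprod a b c d
  rw [Finset.sum_add_distrib] at h1 h2
  have hlast : ∑ e, ∑ f, gi x e f * (christoffelLower dg e a d * christoffelLower dg f b c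
      - christoffelLower dg e a c * christoffelLower dg f b d) =
      ∑ e, (christoffelLower dg e a d * christoffel g x e b c
        - christoffelLower dg e a c * christoffel g x e b d) := by
    refine Finset.sum_congr rfl fun e _ => ?_
    rw [hup e b c, hup e b d, Finset.mul_sum, Finset.mul_sum, ← Finset.sum_sub_distrib]
    exact Finset.sum_congr rfl fun f _ => by ring
  have h3 : ∑ e, dg c a e * christoffel g x e b d =
      ∑ e, christoffelLower dg a c e * christoffel g x e b d
      + ∑ e, christoffelLower dg e a c * christoffel g x e b d := by
    rw [← Finset.sum_add_distrib]
    exact Finset.sum_congr rfl fun e _ => by rw [hdgL c a e]; ring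
  have h4 : ∑ e, dg d a e * christoffel g x e b c =
      ∑ e, christoffelLower dg a d e * christoffel g x e b c
      + ∑ e, christoffelLower dg e a d * christoffel g x e b c := by
    rw [← Finset.sum_add_distrib]
    exact Finset.sum_congr rfl fun e _ => by rw [hdgL d a e]; ring
  rw [hsplit, curvatureOfJet, hlast, Finset.sum_sub_distrib, Finset.sum_sub_distrib]
  have h5 := hddgc c d a b
  linarith

theorem ricci_eq (b d : Fin 4) :
    ricci g x b d = ∑ a, ∑ e, (g x)⁻¹ a e * riemann g x e b a d := by
  have h1 := h.mul_eq_one.self_of_nhds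
  have h2 : gi x * g x = 1 := mul_eq_one_comm.1 h1
  rw [h.inv_eq.self_of_nhds]
  refine Finset.sum_congr rfl fun a _ => ?_
  simp only [riemann, Finset.mul_sum]
  rw [Finset.sum_comm]
  simp only [← mul_assoc, ← Finset.sum_mul]
  have : ∀ d, ∑ e, gi x a e * g x e d = if a = d then 1 else 0 := by
    intro d
    rw [← Matrix.mul_apply, h2, Matrix.one_apply]
  simp [this]

end IsMetricInverse

/-! ### Calculus of two-jets -/

/-- `f` is of class `C²` at `x`, with gradient `d` and Hessian `h` there. -/
structure HasJet (f : Coord → ℝ) (x : Coord) (d : Fin 4 → ℝ) (h : Fin 4 → Fin 4 → ℝ) : Prop where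
  smooth : ContDiffAt ℝ 2 f x
  grad : ∀ i, pderiv i f x = d i
  hess : ∀ i j, pderiv i (pderiv j f) x = h i j

theorem eventually_contDiffAt_two {f : Coord → ℝ} {x : Coord} (h : ContDiffAt ℝ 2 f x) :
    ∀ᶠ y in 𝓝 x, ContDiffAt ℝ 2 f y :=
  h.eventually (by simp)

namespace HasJet

variable {f g : Coord → ℝ} {x : Coord} {d d' : Fin 4 → ℝ} {h h' : Fin 4 → Fin 4 → ℝ}

theorem differentiableAt (H : HasJet f x d h) : DifferentiableAt ℝ f x :=
  H.smooth.differentiableAt (by simp)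

theorem of_contDiffAt (H : ContDiffAt ℝ 2 f x) :
    HasJet f x (fun i => pderiv i f x) (fun i j => pderiv i (pderiv j f) x) :=
  ⟨H, fun _ => rfl, fun _ _ => rfl⟩

theorem symm (H : HasJet f x d h) (i j : Fin 4) : h i j = h j i := by
  rw [← H.hess, ← H.hess, pderiv_comm H.smooth]

theorem const (c : ℝ) : HasJet (fun _ => c) x 0 0 := by
  have : ∀ i, pderiv i (fun _ : Coord => c) = fun _ => 0 := by
    intro i; ext y; simp [pderiv]
  refine ⟨contDiffAt_const, fun i => by simp [this], fun i j => ?_⟩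
  rw [this]; simp [pderiv]

theorem coord (k : Fin 4) : HasJet (fun y => y k) x (Pi.single k 1) 0 := by
  have : ∀ i, pderiv i (fun y : Coord => y k) = fun _ => (Pi.single k 1 : Fin 4 → ℝ) i := by
    intro i; ext y
    have : HasFDerivAt (fun y : Coord => y k) (ContinuousLinearMap.proj k : Coord →L[ℝ] ℝ) y :=
      (ContinuousLinearMap.proj (R := ℝ) (φ := fun _ : Fin 4 => ℝ) k).hasFDerivAt
    simp [pderiv, this.fderiv, Pi.single_apply, eq_comm]
  refine ⟨contDiffAt_apply ℝ ℝ k x, fun i => by rw [this], fun i j => ?_⟩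
  rw [this]; simp [pderiv]

theorem add (H : HasJet f x d h) (H' : HasJet g x d' h') :
    HasJet (fun y => f y + g y) x (fun i => d i + d' i) (fun i j => h i j + h' i j) := by
  refine ⟨H.smooth.add H'.smooth, fun i => ?_, fun i j => ?_⟩
  · rw [pderiv_add H.differentiableAt H'.differentiableAt, H.grad, H'.grad]
  · have : pderiv j (fun y => f y + g y) =ᶠ[𝓝 x] fun y => pderiv j f y + pderiv j g y := by
      filter_upwards [eventually_contDiffAt_two H.smooth, eventually_contDiffAt_two H'.smooth]
        with y h1 h2
      exact pderiv_add (h1.differentiableAt (by simp)) (h2.differentiableAt (by simp)) j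
    rw [pderiv_congr this, pderiv_add (differentiableAt_pderiv H.smooth j)
      (differentiableAt_pderiv H'.smooth j), H.hess, H'.hess]

theorem mul (H : HasJet f x d h) (H' : HasJet g x d' h') :
    HasJet (fun y => f y * g y) x (fun i => d i * g x + f x * d' i)
      (fun i j => h i j * g x + d j * d' i + d i * d' j + f x * h' i j) := by
  refine ⟨H.smooth.mul H'.smooth, fun i => ?_, fun i j => ?_⟩
  · rw [pderiv_mul H.differentiableAt H'.differentiableAt, H.grad, H'.grad]
  · have : pderiv j (fun y => f y * g y) =ᶠ[𝓝 x]
        fun y => pderiv j f y * g y + f y * pderiv j g y := by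
      filter_upwards [eventually_contDiffAt_two H.smooth, eventually_contDiffAt_two H'.smooth]
        with y h1 h2
      exact pderiv_mul (h1.differentiableAt (by simp)) (h2.differentiableAt (by simp)) j
    have e1 := differentiableAt_pderiv H.smooth j
    have e2 := differentiableAt_pderiv H'.smooth j
    rw [pderiv_congr this, pderiv_add (e1.fun_mul H'.differentiableAt)
      (H.differentiableAt.fun_mul e2),
      pderiv_mul e1 H'.differentiableAt, pderiv_mul H.differentiableAt e2,
      H.grad, H'.grad, H.hess, H'.hess, H.grad, H'.grad]
    ring

theorem const_mul (c : ℝ) (H : HasJet f x d h) :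
    HasJet (fun y => c * f y) x (fun i => c * d i) (fun i j => c * h i j) := by
  have := (const (x := x) c).mul H
  refine ⟨this.smooth, fun i => ?_, fun i j => ?_⟩
  · rw [this.grad]; simp
  · rw [this.hess]; simp

theorem sub (H : HasJet f x d h) (H' : HasJet g x d' h') :
    HasJet (fun y => f y - g y) x (fun i => d i - d' i) (fun i j => h i j - h' i j) := by
  have := H.add (H'.const_mul (-1))
  refine ⟨H.smooth.sub H'.smooth, fun i => ?_, fun i j => ?_⟩
  · simpa [sub_eq_add_neg] using this.grad i
  · simpa [sub_eq_add_neg] using this.hess i j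

theorem neg (H : HasJet f x d h) :
    HasJet (fun y => -f y) x (fun i => -d i) (fun i j => -h i j) := by
  have := H.const_mul (-1)
  exact ⟨H.smooth.neg, by simpa using this.grad, by simpa using this.hess⟩

theorem comp {φ : ℝ → ℝ} (hφ : ContDiffAt ℝ 2 φ (f x)) (H : HasJet f x d h) :
    HasJet (fun y => φ (f y)) x (fun i => deriv φ (f x) * d i)
      (fun i j => deriv (deriv φ) (f x) * d i * d j + deriv φ (f x) * h i j) := by
  -- The chain rule is needed for `φ` at points near `x` and for `deriv φ` at `x`, hence the general
  -- `ψ` and `y`.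
  have key : ∀ {ψ : ℝ → ℝ} {y : Coord}, DifferentiableAt ℝ ψ (f y) → DifferentiableAt ℝ f y →
      ∀ i, pderiv i (fun z => ψ (f z)) y = deriv ψ (f y) * pderiv i f y := by
    intro ψ y h1 h2 i
    have := (h1.hasDerivAt.comp_hasFDerivAt y h2.hasFDerivAt).fderiv
    simp only [pderiv]
    rw [show (fun z => ψ (f z)) = ψ ∘ f from rfl, this]
    simp
  have hφ' : ContDiffAt ℝ 1 (deriv φ) (f x) := by
    have := (hφ.fderiv_right (m := 1) (by norm_num)).clm_apply (contDiffAt_const (c := (1 : ℝ)))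
    exact this
  refine ⟨hφ.comp x H.smooth, fun i => ?_, fun i j => ?_⟩
  · rw [key (hφ.differentiableAt (by simp)) H.differentiableAt, H.grad]
  · have : pderiv j (fun y => φ (f y)) =ᶠ[𝓝 x] fun y => deriv φ (f y) * pderiv j f y := by
      filter_upwards [eventually_contDiffAt_two H.smooth,
        H.smooth.continuousAt.eventually (hφ.eventually (by simp))] with y h1 h2
      exact key (h2.differentiableAt (by simp)) (h1.differentiableAt (by simp)) j
    have hd := hφ'.differentiableAt (by simp)
    rw [pderiv_congr this, pderiv_mul (f := fun y => deriv φ (f y)) (hd.comp x H.differentiableAt)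
      (differentiableAt_pderiv H.smooth j), key hd H.differentiableAt, H.hess, H.grad, H.grad]

theorem inv (H : HasJet f x d h) (h0 : f x ≠ 0) :
    HasJet (fun y => (f y)⁻¹) x (fun i => -d i / f x ^ 2)
      (fun i j => 2 * d i * d j / f x ^ 3 - h i j / f x ^ 2) := by
  have := comp (φ := fun t => t⁻¹) (contDiffAt_inv ℝ h0) H
  have e : deriv (fun t : ℝ => t⁻¹) = fun t => -(t ^ 2)⁻¹ := by ext t; simp
  have e2 : deriv (deriv (fun t : ℝ => t⁻¹)) (f x) = 2 / f x ^ 3 := by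
    rw [e]
    have h1 : HasDerivAt (fun t : ℝ => -(t ^ 2)⁻¹) (2 / f x ^ 3) (f x) := by
      have h2 := ((hasDerivAt_pow 2 (f x)).inv (pow_ne_zero 2 h0)).neg
      have h3 : 2 / f x ^ 3 = -(-(((2 : ℕ) : ℝ) * f x ^ (2 - 1)) / (f x ^ 2) ^ 2) := by
        norm_num
        field_simp
      rw [h3]
      exact h2
    exact h1.deriv
  refine ⟨this.smooth, fun i => ?_, fun i j => ?_⟩
  · rw [this.grad, e]; field_simp
  · rw [this.hess, e2, e]; field_simp; ring

theorem cast (H : HasJet f x d h) (hd : ∀ i, d i = d' i) (hh : ∀ i j, h i j = h' i j) :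
    HasJet f x d' h' :=
  ⟨H.smooth, fun i => (H.grad i).trans (hd i), fun i j => (H.hess i j).trans (hh i j)⟩

end HasJet

/-! ### Curvature of block and warped metrics -/

section BlockMetric

variable {p q F : Coord → ℝ} {x : Coord} {dp dq dF : Fin 4 → ℝ} {hp hq hF : Fin 4 → Fin 4 → ℝ}

theorem hasJet_block (Hp : HasJet p x dp hp) (Hq : HasJet q x dq hq) (HF : HasJet F x dF hF)
    (i j : Fin 4) :
    HasJet (fun y => block (p y) (q y) (F y) i j) x (fun k => block (dp k) (dq k) (dF k) i j)
      (fun k l => block (hp k l) (hq k l) (hF k l) i j) := by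
  have H0 := HasJet.const (x := x) 0
  fin_cases i <;> fin_cases j <;> first
    | exact H0 | exact Hp | exact HF | exact Hq.neg

theorem isMetricInverse_block (Hp : HasJet p x dp hp) (Hq : HasJet q x dq hq)
    (HF : HasJet F x dF hF) (hp0 : p x ≠ 0) (hq0 : q x ≠ 0) :
    IsMetricInverse (fun y => block (p y) (q y) (F y)) (fun y => blockInv (p y) (q y) (F y)) x where
  smooth i j := (hasJet_block Hp Hq HF i j).smooth
  symm := Eventually.of_forall fun y i j => by fin_cases i <;> fin_cases j <;> rfl
  mul_eq_one := by
    filter_upwards [Hp.smooth.continuousAt.eventually_ne hp0,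
      Hq.smooth.continuousAt.eventually_ne hq0] with y h1 h2
    exact block_mul_blockInv h1 h2
  differentiable i j := by
    have e0 : DifferentiableAt ℝ (fun _ : Coord => (0 : ℝ)) x := differentiableAt_const _
    have e1 := Hp.differentiableAt.fun_inv hp0
    have e2 := (Hq.differentiableAt.fun_inv hq0).fun_neg
    have e3 := (HF.differentiableAt.fun_mul
      ((Hq.differentiableAt.fun_pow 2).fun_inv (pow_ne_zero 2 hq0))).fun_neg
    fin_cases i <;> fin_cases j <;> first
      | exact e0 | exact e1 | exact e2 | exact e3

theorem riemann_block (Hp : HasJet p x dp hp) (Hq : HasJet q x dq hq)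
    (HF : HasJet F x dF hF) (hp0 : p x ≠ 0) (hq0 : q x ≠ 0) (a b c d : Fin 4) :
    riemann (fun y => block (p y) (q y) (F y)) x a b c d =
      curvatureOfJet (blockInv (p x) (q x) (F x)) (fun k i j => block (dp k) (dq k) (dF k) i j)
        (fun k l i j => block (hp k l) (hq k l) (hF k l) i j) a b c d := by
  rw [(isMetricInverse_block Hp Hq HF hp0 hq0).riemann_eq]
  simp only [(hasJet_block Hp Hq HF _ _).grad, (hasJet_block Hp Hq HF _ _).hess]

/-- Independence of `p` from `u, v` and of `q` from `v` makes many components vanish outright. Each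
numbered hypothesis prescribes one of the others; `h0213` serves both `R₀₂₁₃` and `R₀₃₁₂`, which
coincide here. -/
theorem riemann_block_eq_curvForm {c₁ c₂ c₃ s₁ s₂ t : ℝ} (Hp : HasJet p x dp hp)
    (Hq : HasJet q x dq hq) (HF : HasJet F x dF hF) (hp0 : p x ≠ 0) (hq0 : q x ≠ 0)
    (dp2 : dp 2 = 0) (dp3 : dp 3 = 0) (dq3 : dq 3 = 0)
    (hp2 : ∀ i, hp i 2 = 0) (hp3 : ∀ i, hp i 3 = 0) (hq3 : ∀ i, hq i 3 = 0)
    (h0101 : -(hp 0 0 + hp 1 1) / 2 + (dp 0 ^ 2 + dp 1 ^ 2) / (2 * p x) = c₁)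
    (h2323 : -hF 3 3 / 2 + (dq 0 ^ 2 + dq 1 ^ 2) / (4 * p x) = c₂)
    (h0203 : hq 0 0 / 2 - dq 0 ^ 2 / (4 * q x) - (dp 0 * dq 0 - dp 1 * dq 1) / (4 * p x) = c₃)
    (h1213 : hq 1 1 / 2 - dq 1 ^ 2 / (4 * q x) - (dp 1 * dq 1 - dp 0 * dq 0) / (4 * p x) = c₃)
    (h0213 : hq 0 1 / 2 - dq 0 * dq 1 / (4 * q x) - (dp 1 * dq 0 + dp 0 * dq 1) / (4 * p x) = 0)
    (h0223 : (hq 0 2 + hF 0 3) / 2 - dq 0 * (dq 2 + dF 3) / (2 * q x) = 0)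
    (h1223 : (hq 1 2 + hF 1 3) / 2 - dq 1 * (dq 2 + dF 3) / (2 * q x) = 0)
    (h0202 : -hF 0 0 / 2 + dF 0 * dq 0 / (2 * q x) - F x * dq 0 ^ 2 / (4 * q x ^ 2)
      + (dp 0 * dF 0 - dp 1 * dF 1) / (4 * p x) = s₁)
    (h1212 : -hF 1 1 / 2 + dF 1 * dq 1 / (2 * q x) - F x * dq 1 ^ 2 / (4 * q x ^ 2)
      + (dp 1 * dF 1 - dp 0 * dF 0) / (4 * p x) = s₂)
    (h0212 : -hF 0 1 / 2 + (dF 0 * dq 1 + dF 1 * dq 0) / (4 * q x)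
      - F x * (dq 0 * dq 1) / (4 * q x ^ 2) + (dp 1 * dF 0 + dp 0 * dF 1) / (4 * p x) = t)
    (a b c d : Fin 4) :
    riemann (fun y => block (p y) (q y) (F y)) x a b c d = curvForm c₁ c₂ c₃ s₁ s₂ t a b c d := by
  rw [riemann_block Hp Hq HF hp0 hq0]
  have hgi : ∀ i j, blockInv (p x) (q x) (F x) i j = blockInv (p x) (q x) (F x) j i := by
    intro i j; fin_cases i <;> fin_cases j <;> rfl
  have hbl : ∀ p q F i j, block p q F i j = block p q F j i := by
    intro p q F i j; fin_cases i <;> fin_cases j <;> rfl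
  have h2p : ∀ i, hp 2 i = 0 := fun i => (Hp.symm 2 i).trans (hp2 i)
  have h3p : ∀ i, hp 3 i = 0 := fun i => (Hp.symm 3 i).trans (hp3 i)
  have h3q : ∀ i, hq 3 i = 0 := fun i => (Hq.symm 3 i).trans (hq3 i)
  refine eq_curvForm (fun a b c d => curvatureOfJet_swap _ hgi a b c d)
    (fun a b c d => curvatureOfJet_pair hgi (fun _ => hbl _ _ _) (fun _ _ => hbl _ _ _)
      (fun k l i j => ?_) a b c d)
    (Eq.trans ?_ h0101) ?_ ?_ ?_ ?_ ?_ (Eq.trans ?_ h0202) (Eq.trans ?_ h0203) (Eq.trans ?_ h0212)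
    (Eq.trans ?_ h0213) (Eq.trans ?_ h0223) ?_ (Eq.trans ?_ h0213) ?_ ?_ (Eq.trans ?_ h1212) (Eq.trans ?_ h1213)
    (Eq.trans ?_ h1223) ?_ ?_ (Eq.trans ?_ h2323) a b c d
  · simp only [Hp.symm k l, Hq.symm k l, HF.symm k l]
  all_goals
    simp [curvatureOfJet, christoffelLower, Fin.sum_univ_four, block, blockInv, dp2, dp3, dq3,
      hp2, hp3, hq3, h2p, h3p, h3q, Hq.symm 1 0, Hq.symm 2 0, Hq.symm 2 1, HF.symm 1 0,
      HF.symm 3 0, HF.symm 3 1, HF.symm 3 2, HF.symm 2 0, HF.symm 2 1, Hp.symm 1 0]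
  all_goals
    field_simp
    ring

/-- The curvature of `p ((dx⁰)² + (dx¹)²) + W² (-2 du dv + (D v² - 2 (V/W) v - H/W) du²)` with
`V = W_{,u}`, for functions `W` and `V` whose Hessians on the surfaces of constant `u`, `v` are
proportional to the metric. -/
theorem riemann_warped {W V D H : Coord → ℝ} {dW dV dD dH : Fin 4 → ℝ}
    {hW hV hD hH : Fin 4 → Fin 4 → ℝ} {c₁ l μ γ : ℝ}
    (Hp : HasJet p x dp hp) (HW : HasJet W x dW hW) (HV : HasJet V x dV hV)
    (HD : HasJet D x dD hD) (HH : HasJet H x dH hH) (hp0 : p x ≠ 0) (hW0 : W x ≠ 0)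
    (dp2 : dp 2 = 0) (dp3 : dp 3 = 0) (dW2 : dW 2 = V x) (dW3 : dW 3 = 0) (dV3 : dV 3 = 0)
    (dD0 : dD 0 = 0) (dD1 : dD 1 = 0) (dD3 : dD 3 = 0) (dH3 : dH 3 = 0)
    (hp2 : ∀ i, hp i 2 = 0) (hp3 : ∀ i, hp i 3 = 0) (hW3 : ∀ i, hW i 3 = 0)
    (hV3 : ∀ i, hV i 3 = 0) (hD0 : ∀ i, hD 0 i = 0) (hD1 : ∀ i, hD 1 i = 0)
    (hD3 : ∀ i, hD i 3 = 0)
    (hH3 : ∀ i, hH i 3 = 0) (hW02 : hW 0 2 = dV 0) (hW12 : hW 1 2 = dV 1)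
    (h0101 : -(hp 0 0 + hp 1 1) / 2 + (dp 0 ^ 2 + dp 1 ^ 2) / (2 * p x) = c₁)
    (hW00 : hW 0 0 = l * p x + (dp 0 * dW 0 - dp 1 * dW 1) / (2 * p x))
    (hW11 : hW 1 1 = l * p x + (dp 1 * dW 1 - dp 0 * dW 0) / (2 * p x))
    (hW01 : hW 0 1 = (dp 1 * dW 0 + dp 0 * dW 1) / (2 * p x))
    (hV00 : hV 0 0 = μ * p x + (dp 0 * dV 0 - dp 1 * dV 1) / (2 * p x))
    (hV11 : hV 1 1 = μ * p x + (dp 1 * dV 1 - dp 0 * dV 0) / (2 * p x))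
    (hV01 : hV 0 1 = (dp 1 * dV 0 + dp 0 * dV 1) / (2 * p x))
    (hγ : dW 0 ^ 2 + dW 1 ^ 2 = γ * p x) (a b c d : Fin 4) :
    riemann (fun y => block (p y) (W y * W y)
        (W y * (D y * W y * (y 3 * y 3) - 2 * (V y * y 3) - H y))) x a b c d =
      curvForm c₁ (W x ^ 2 * (γ - D x)) (W x * l * p x)
        (-(W x * (D x * x 3 ^ 2 * l - 2 * x 3 * μ)
            + (D x * W x * x 3 ^ 2 - 2 * V x * x 3 - H x) * l) / 2 * p x
          + W x / 2 * (hH 0 0 - (dp 0 * dH 0 - dp 1 * dH 1) / (2 * p x)))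
        (-(W x * (D x * x 3 ^ 2 * l - 2 * x 3 * μ)
            + (D x * W x * x 3 ^ 2 - 2 * V x * x 3 - H x) * l) / 2 * p x
          + W x / 2 * (hH 1 1 - (dp 1 * dH 1 - dp 0 * dH 0) / (2 * p x)))
        (W x / 2 * (hH 0 1 - (dp 1 * dH 0 + dp 0 * dH 1) / (2 * p x))) a b c d := by
  have Hv := HasJet.coord (x := x) 3
  have HF := HW.mul (((HD.mul HW).mul (Hv.mul Hv)).sub ((HV.mul Hv).const_mul 2) |>.sub HH)
  have s30 : (Pi.single (M := fun _ : Fin 4 => ℝ) 3 1 : Fin 4 → ℝ) 0 = 0 := by simp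
  have s31 : (Pi.single (M := fun _ : Fin 4 => ℝ) 3 1 : Fin 4 → ℝ) 1 = 0 := by simp
  have s33 : (Pi.single (M := fun _ : Fin 4 => ℝ) 3 1 : Fin 4 → ℝ) 3 = 1 := by simp
  refine riemann_block_eq_curvForm Hp (HW.mul HW) HF hp0 (mul_ne_zero hW0 hW0) dp2 dp3
    ?_ hp2 hp3 ?_ h0101 ?_ ?_ ?_ ?_ ?_ ?_ ?_ ?_ ?_ a b c d
  all_goals
    simp only [dW2, dW3, dV3, dD0, dD1, dD3, dH3, hW3, hV3, hD0, hD1, hD3, hH3, hW02, hW12,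
      hW00, hW11, hW01, hV00, hV11, hV01, s30, s31, s33, Pi.zero_apply, mul_zero, zero_mul,
      add_zero, zero_add, sub_zero, implies_true]
  -- This is `R₂₃₂₃`, with `q = W²` and `F_{,vv} = 2 D W²`: the only component in which the squared
  -- gradient `dW₀² + dW₁²` has to be replaced by `γ p`.
  · field_simp
    linear_combination 8 * hγ
  all_goals
    field_simp
    ring

end BlockMetric

/-! ### Curvature depends only on the germ of the metric -/

section Congr

variable {g g' : MetricField} {x : Coord}

theorem christoffel_congr (h : g =ᶠ[𝓝 x] g') :
    ∀ᶠ y in 𝓝 x, ∀ a b c, christoffel g y a b c = christoffel g' y a b c := by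
  filter_upwards [h.eventuallyEq_nhds] with y hy a b c
  have hp : ∀ k i j, pderiv k (fun z => g z i j) y = pderiv k (fun z => g' z i j) y :=
    fun k i j => pderiv_congr (hy.mono fun z hz => by simp only [hz]) k
  simp only [christoffel, hp, hy.self_of_nhds]

theorem riemannUp_congr (h : g =ᶠ[𝓝 x] g') (a b c d : Fin 4) :
    riemannUp g x a b c d = riemannUp g' x a b c d := by
  have hc := christoffel_congr h
  have hp : ∀ k a b c, pderiv k (fun y => christoffel g y a b c) x =
      pderiv k (fun y => christoffel g' y a b c) x :=
    fun k a b c => pderiv_congr (hc.mono fun y hy => hy a b c) k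
  simp only [riemannUp, hp, hc.self_of_nhds]

theorem riemann_congr (h : g =ᶠ[𝓝 x] g') (a b c d : Fin 4) :
    riemann g x a b c d = riemann g' x a b c d := by
  simp only [riemann, riemannUp_congr h, h.self_of_nhds]

end Congr

/-! ### Jets of functions of `ζ` and `u`, and complex derivatives -/

section Jets

variable {x : Coord}

theorem hasJet_uOf_comp {φ : ℝ → ℝ} (hφ : ContDiffAt ℝ 2 φ (uOf x)) :
    HasJet (fun y => φ (uOf y)) x ![0, 0, deriv φ (uOf x), 0]
      !![0, 0, 0, 0; 0, 0, 0, 0; 0, 0, deriv (deriv φ) (uOf x), 0; 0, 0, 0, 0] := by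
  refine (HasJet.comp hφ (HasJet.coord 2)).cast (fun i => ?_) (fun i j => ?_)
  · fin_cases i <;> simp [uOf]
  · fin_cases i <;> fin_cases j <;> simp [uOf]

theorem hasJet_normSq_zetaOf :
    HasJet (fun y => Complex.normSq (zetaOf y)) x ![2 * x 0, 2 * x 1, 0, 0]
      !![2, 0, 0, 0; 0, 2, 0, 0; 0, 0, 0, 0; 0, 0, 0, 0] := by
  have h0 := HasJet.coord (x := x) 0
  have h1 := HasJet.coord (x := x) 1
  refine ((h0.mul h0).add (h1.mul h1)).cast (fun i => ?_) (fun i j => ?_)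
  · fin_cases i <;> simp <;> ring
  · fin_cases i <;> fin_cases j <;> simp <;> norm_num

theorem hasDerivAt_re {φ : ℝ → ℂ} {s : ℝ} (h : DifferentiableAt ℝ φ s) :
    HasDerivAt (fun s => (φ s).re) (deriv φ s).re s :=
  Complex.reCLM.hasFDerivAt.comp_hasDerivAt s h.hasDerivAt

theorem hasDerivAt_im {φ : ℝ → ℂ} {s : ℝ} (h : DifferentiableAt ℝ φ s) :
    HasDerivAt (fun s => (φ s).im) (deriv φ s).im s :=
  Complex.imCLM.hasFDerivAt.comp_hasDerivAt s h.hasDerivAt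

theorem contDiffAt_deriv {φ : ℝ → ℂ} {s : ℝ} {n : WithTop ℕ∞} (h : ContDiffAt ℝ (n + 1) φ s) :
    ContDiffAt ℝ n (deriv φ) s :=
  (h.fderiv_right le_rfl).clm_apply (contDiffAt_const (c := (1 : ℝ)))

theorem hasJet_re_mul {φ : ℝ → ℂ} (hφ : ContDiffAt ℝ 2 φ (uOf x)) :
    HasJet (fun y => 2 * (φ (uOf y) * zetaOf y).re) x
      ![2 * (φ (uOf x)).re, -(2 * (φ (uOf x)).im), 2 * (deriv φ (uOf x) * zetaOf x).re, 0]
      !![0, 0, 2 * (deriv φ (uOf x)).re, 0; 0, 0, -(2 * (deriv φ (uOf x)).im), 0;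
        2 * (deriv φ (uOf x)).re, -(2 * (deriv φ (uOf x)).im),
          2 * (deriv (deriv φ) (uOf x) * zetaOf x).re, 0; 0, 0, 0, 0] := by
  have hev : ∀ᶠ s in 𝓝 (uOf x), DifferentiableAt ℝ φ s :=
    (hφ.eventually (by simp)).mono fun s hs => hs.differentiableAt (by simp)
  have hd : DifferentiableAt ℝ (deriv φ) (uOf x) :=
    (contDiffAt_deriv (n := 1) (by simpa [one_add_one_eq_two] using hφ)).differentiableAt (by simp)
  have hre : deriv (fun s => (φ s).re) =ᶠ[𝓝 (uOf x)] fun s => (deriv φ s).re :=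
    hev.mono fun s hs => (hasDerivAt_re hs).deriv
  have him : deriv (fun s => (φ s).im) =ᶠ[𝓝 (uOf x)] fun s => (deriv φ s).im :=
    hev.mono fun s hs => (hasDerivAt_im hs).deriv
  have h1 := hasJet_uOf_comp (x := x) (φ := fun s => (φ s).re)
    (Complex.reCLM.contDiff.contDiffAt.comp _ hφ)
  have h2 := hasJet_uOf_comp (x := x) (φ := fun s => (φ s).im)
    (Complex.imCLM.contDiff.contDiffAt.comp _ hφ)
  rw [hre.deriv_eq, hre.self_of_nhds, (hasDerivAt_re hd).deriv] at h1
  rw [him.deriv_eq, him.self_of_nhds, (hasDerivAt_im hd).deriv] at h2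
  refine (((h1.mul (HasJet.coord 0)).sub (h2.mul (HasJet.coord 1))).const_mul 2).cast
    (fun i => ?_) (fun i j => ?_)
  · fin_cases i <;> simp [zetaOf]
  · fin_cases i <;> fin_cases j <;> simp [zetaOf]

end Jets

/-- The map `x ↦ (ζ, u)`. -/
noncomputable def zetaU : Coord →L[ℝ] ℂ × ℝ :=
  ((Complex.equivRealProdCLM.symm : ℝ × ℝ →L[ℝ] ℂ).comp
    ((ContinuousLinearMap.proj (R := ℝ) (φ := fun _ : Fin 4 => ℝ) 0).prod
      (ContinuousLinearMap.proj (R := ℝ) (φ := fun _ : Fin 4 => ℝ) 1))).prod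
    (ContinuousLinearMap.proj (R := ℝ) (φ := fun _ : Fin 4 => ℝ) 2)

theorem zetaU_apply (x : Coord) : zetaU x = (zetaOf x, uOf x) := rfl

theorem zetaU_single_zero : zetaU (Pi.single 0 1) = (1, 0) := by
  simp [zetaU_apply, zetaOf, uOf, Complex.ext_iff]

theorem zetaU_single_one : zetaU (Pi.single 1 1) = (Complex.I, 0) := by
  simp [zetaU_apply, zetaOf, uOf, Complex.ext_iff]

theorem zetaU_single_three : zetaU (Pi.single 3 1) = 0 := by
  simp [zetaU_apply, zetaOf, uOf, Complex.ext_iff, Prod.ext_iff]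

theorem isOpen_domainOver {S : Set (ℂ × ℝ)} (hS : IsOpen S) : IsOpen (domainOver S) :=
  hS.preimage zetaU.continuous

theorem pderiv_comp_zetaU {f : ℂ × ℝ → ℝ} {x : Coord} (hf : DifferentiableAt ℝ f (zetaU x))
    (i : Fin 4) :
    pderiv i (fun y => f (zetaU y)) x = fderiv ℝ f (zetaU x) (zetaU (Pi.single i 1)) := by
  have := (hf.hasFDerivAt.comp x zetaU.hasFDerivAt).fderiv
  simp only [pderiv]
  rw [show (fun y => f (zetaU y)) = f ∘ zetaU from rfl, this]
  rfl

section Slice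

variable {f : ℂ × ℝ → ℝ} {z : ℂ} {u : ℝ}

theorem hasFDerivAt_slice (hf : DifferentiableAt ℝ f (z, u)) :
    HasFDerivAt (fun z => f (z, u))
      ((fderiv ℝ f (z, u)).comp (ContinuousLinearMap.inl ℝ ℂ ℝ)) z :=
  HasFDerivAt.comp (g := f) z hf.hasFDerivAt (hasFDerivAt_prodMk_left z u)

theorem fderiv_slice (hf : DifferentiableAt ℝ f (z, u)) (w : ℂ) :
    fderiv ℝ (fun z => f (z, u)) z w = fderiv ℝ f (z, u) (w, 0) := by
  rw [(hasFDerivAt_slice hf).fderiv]; simp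

theorem fderiv_ofReal {g : ℂ → ℝ} (hg : DifferentiableAt ℝ g z) (w : ℂ) :
    fderiv ℝ (fun z => (g z : ℂ)) z w = (fderiv ℝ g z w : ℝ) := by
  have := (Complex.ofRealCLM.hasFDerivAt (x := g z)).comp z hg.hasFDerivAt
  rw [show (fun z => (g z : ℂ)) = Complex.ofRealCLM ∘ g from rfl, this.fderiv]
  rfl

theorem fderiv_ofReal_add_mul {a b : ℂ → ℝ} (ha : DifferentiableAt ℝ a z)
    (hb : DifferentiableAt ℝ b z) (c w : ℂ) :
    fderiv ℝ (fun z => (1 / 2) * ((a z : ℂ) + c * (b z : ℂ))) z w =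
      (1 / 2) * ((fderiv ℝ a z w : ℝ) + c * (fderiv ℝ b z w : ℝ)) := by
  have ha' : DifferentiableAt ℝ (fun z => (a z : ℂ)) z :=
    (Complex.ofRealCLM.differentiableAt (x := a z)).comp z ha
  have hb' : DifferentiableAt ℝ (fun z => (b z : ℂ)) z :=
    (Complex.ofRealCLM.differentiableAt (x := b z)).comp z hb
  rw [fderiv_const_mul (ha'.fun_add (hb'.const_mul c)), fderiv_fun_add ha' (hb'.const_mul c),
    fderiv_const_mul hb']
  simp [fderiv_ofReal ha, fderiv_ofReal hb]
  ring

theorem dZeta_slice (hf : DifferentiableAt ℝ f (z, u)) :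
    dZeta (fun z => (f (z, u) : ℂ)) z = (1 / 2) * ((fderiv ℝ f (z, u) (1, 0) : ℝ)
      + -Complex.I * (fderiv ℝ f (z, u) (Complex.I, 0) : ℝ)) := by
  have := (hasFDerivAt_slice hf).differentiableAt
  simp only [dZeta, fderiv_ofReal this, fderiv_slice hf]
  ring

theorem dZetaBar_slice (hf : DifferentiableAt ℝ f (z, u)) :
    dZetaBar (fun z => (f (z, u) : ℂ)) z = (1 / 2) * ((fderiv ℝ f (z, u) (1, 0) : ℝ)
      + Complex.I * (fderiv ℝ f (z, u) (Complex.I, 0) : ℝ)) := by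
  have := (hasFDerivAt_slice hf).differentiableAt
  simp only [dZetaBar, fderiv_ofReal this, fderiv_slice hf]

theorem eventually_contDiffAt_slice (hf : ContDiffAt ℝ 2 f (z, u)) :
    ∀ᶠ w in 𝓝 z, ContDiffAt ℝ 2 f (w, u) :=
  (Continuous.prodMk_left u).continuousAt.eventually (hf.eventually (by simp))

theorem dZeta_congr {f g : ℂ → ℂ} (h : f =ᶠ[𝓝 z] g) : dZeta f z = dZeta g z := by
  simp only [dZeta, h.fderiv_eq]

theorem differentiableAt_fderiv_apply (hf : ContDiffAt ℝ 2 f (z, u)) (v : ℂ × ℝ) :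
    DifferentiableAt ℝ (fun q => fderiv ℝ f q v) (z, u) :=
  ((hf.fderiv_right (m := 1) (by norm_num)).clm_apply contDiffAt_const).differentiableAt (by simp)

theorem dZeta_half_add_mul (hf : ContDiffAt ℝ 2 f (z, u)) (c : ℂ) :
    dZeta (fun w => (1 / 2) * ((fderiv ℝ f (w, u) (1, 0) : ℝ)
        + c * (fderiv ℝ f (w, u) (Complex.I, 0) : ℝ))) z =
      (1 / 4) * ((fderiv ℝ (fun q => fderiv ℝ f q (1, 0)) (z, u) (1, 0) : ℝ)
        + c * (fderiv ℝ (fun q => fderiv ℝ f q (Complex.I, 0)) (z, u) (1, 0) : ℝ)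
        - Complex.I * ((fderiv ℝ (fun q => fderiv ℝ f q (1, 0)) (z, u) (Complex.I, 0) : ℝ)
        + c * (fderiv ℝ (fun q => fderiv ℝ f q (Complex.I, 0)) (z, u) (Complex.I, 0) : ℝ))) := by
  have h1 := differentiableAt_fderiv_apply hf (1, 0)
  have h2 := differentiableAt_fderiv_apply hf (Complex.I, 0)
  have e1 := (hasFDerivAt_slice h1).differentiableAt
  have e2 := (hasFDerivAt_slice h2).differentiableAt
  simp only [dZeta, fderiv_ofReal_add_mul e1 e2, fderiv_slice h1, fderiv_slice h2]
  ring

end Slice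

section Jets

variable {f : ℂ × ℝ → ℝ} {x : Coord} {d : Fin 4 → ℝ} {h : Fin 4 → Fin 4 → ℝ}

theorem contDiffAt_comp_zetaU (hf : ContDiffAt ℝ 2 f (zetaU x)) :
    ContDiffAt ℝ 2 (fun y => f (zetaU y)) x :=
  hf.comp x zetaU.contDiff.contDiffAt

theorem pderiv_pderiv_comp_zetaU (hf : ContDiffAt ℝ 2 f (zetaU x)) (i j : Fin 4) :
    pderiv i (pderiv j fun y => f (zetaU y)) x =
      fderiv ℝ (fun q => fderiv ℝ f q (zetaU (Pi.single j 1))) (zetaU x)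
        (zetaU (Pi.single i 1)) := by
  have : pderiv j (fun y => f (zetaU y)) =ᶠ[𝓝 x]
      fun y => (fun q => fderiv ℝ f q (zetaU (Pi.single j 1))) (zetaU y) := by
    filter_upwards [zetaU.continuous.continuousAt.eventually (hf.eventually (by simp))] with y hy
    exact pderiv_comp_zetaU (hy.differentiableAt (by simp)) j
  rw [pderiv_congr this, pderiv_comp_zetaU (differentiableAt_fderiv_apply hf _)]

/-- The jet of a function of `(ζ, u)`. -/
theorem exists_hasJet_comp_zetaU (hf : ContDiffAt ℝ 2 f (zetaU x)) :
    ∃ d h, HasJet (fun y => f (zetaU y)) x d h ∧ d 3 = 0 ∧ ∀ i, h i 3 = 0 := by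
  refine ⟨_, _, HasJet.of_contDiffAt (contDiffAt_comp_zetaU hf), ?_, fun i => ?_⟩
  · rw [pderiv_comp_zetaU (hf.differentiableAt (by simp)), zetaU_single_three, map_zero]
  · rw [pderiv_pderiv_comp_zetaU hf, zetaU_single_three]
    simp

/-- With `u` frozen, `4 f_{,ζζ} = f_xx - f_yy - 2i f_xy`. This links the complex derivatives in the
statement to the coordinate Hessian in the curvature formulas. -/
theorem dZeta_dZeta_eq (hf : ContDiffAt ℝ 2 f (zetaU x))
    (H : HasJet (fun y => f (zetaU y)) x d h) :
    dZeta (dZeta fun z => (f (z, uOf x) : ℂ)) (zetaOf x) =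
      (1 / 4) * ((h 0 0 - h 1 1 : ℝ) - 2 * Complex.I * (h 0 1 : ℝ)) := by
  have hev : dZeta (fun z => (f (z, uOf x) : ℂ)) =ᶠ[𝓝 (zetaOf x)] fun w =>
      (1 / 2) * ((fderiv ℝ f (w, uOf x) (1, 0) : ℝ)
        + -Complex.I * (fderiv ℝ f (w, uOf x) (Complex.I, 0) : ℝ)) :=
    (eventually_contDiffAt_slice hf).mono fun w hw => dZeta_slice (hw.differentiableAt (by simp))
  rw [dZeta_congr hev, dZeta_half_add_mul (z := zetaOf x) (u := uOf x) hf]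
  simp only [← zetaU_single_zero, ← zetaU_single_one, ← zetaU_apply,
    ← pderiv_pderiv_comp_zetaU hf, H.hess, H.symm 1 0]
  push_cast
  linear_combination (1 / 4 * (h 1 1 : ℂ)) * Complex.I_mul_I

theorem dZeta_dZetaBar_eq (hf : ContDiffAt ℝ 2 f (zetaU x))
    (H : HasJet (fun y => f (zetaU y)) x d h) :
    dZeta (dZetaBar fun z => (f (z, uOf x) : ℂ)) (zetaOf x) =
      (1 / 4) * (h 0 0 + h 1 1 : ℝ) := by
  have hev : dZetaBar (fun z => (f (z, uOf x) : ℂ)) =ᶠ[𝓝 (zetaOf x)] fun w =>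
      (1 / 2) * ((fderiv ℝ f (w, uOf x) (1, 0) : ℝ)
        + Complex.I * (fderiv ℝ f (w, uOf x) (Complex.I, 0) : ℝ)) :=
    (eventually_contDiffAt_slice hf).mono fun w hw =>
      dZetaBar_slice (hw.differentiableAt (by simp))
  rw [dZeta_congr hev, dZeta_half_add_mul (z := zetaOf x) (u := uOf x) hf]
  simp only [← zetaU_single_zero, ← zetaU_single_one, ← zetaU_apply,
    ← pderiv_pderiv_comp_zetaU hf, H.hess, H.symm 1 0]
  push_cast
  linear_combination (-1 / 4 * (h 1 1 : ℂ)) * Complex.I_mul_I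

end Jets

/-! ### The metrics of the family and their curvature tensor -/

namespace WaveData

variable (w : WaveData)

/-- `Q_{,u}`. -/
noncomputable def Qdot (ζ : ℂ) (u : ℝ) : ℝ := 2 * (deriv w.C u * ζ).re

/-- The regularity and non-degeneracy of the data at a point `(ζ, u)`. -/
structure RegularAt (ζ : ℂ) (u : ℝ) : Prop where
  P_ne : w.P ζ ≠ 0
  Q_ne : w.Q ζ u ≠ 0
  C_smooth : ContDiffAt ℝ 3 w.C u
  D_smooth : ContDiffAt ℝ 2 w.D u
  H_smooth : ContDiffAt ℝ 2 (fun q : ℂ × ℝ => w.H q.1 q.2) (ζ, u)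

variable {w} {x : Coord}

theorem hasDerivAt_Q {ζ : ℂ} {u : ℝ} (h : DifferentiableAt ℝ w.C u) :
    HasDerivAt (fun s => w.Q ζ s) (w.Qdot ζ u) u := by
  have h1 := (hasDerivAt_re (φ := fun s => w.C s * ζ) (h.mul_const ζ)).const_mul 2
  rw [deriv_mul_const h] at h1
  exact h1.const_add _

theorem F_eq {ζ : ℂ} {u : ℝ} (h : DifferentiableAt ℝ w.C u) (v : ℝ) :
    w.F ζ u v = w.Q ζ u * (w.P ζ)⁻¹ * (w.D u * (w.Q ζ u * (w.P ζ)⁻¹) * (v * v)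
      - 2 * (w.Qdot ζ u * (w.P ζ)⁻¹ * v) - w.H ζ u) := by
  have : deriv (fun s => w.Q ζ s ^ 2) u = 2 * w.Q ζ u * w.Qdot ζ u := by
    simpa using ((hasDerivAt_Q (ζ := ζ) h).fun_pow 2).deriv
  rw [F, this]
  ring

theorem metric_eq_block (x : Coord) : w.metric x =
    block (2 / w.P (zetaOf x) ^ 2) (w.Q (zetaOf x) (uOf x) ^ 2 / w.P (zetaOf x) ^ 2)
      (w.F (zetaOf x) (uOf x) (vOf x)) := rfl

/-- `F` contains a derivative in `u`. Near a regular point it is rewritten in terms of `Q_{,u}`,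
which is of class `C²` there because `C` is of class `C³`; the metric then has a computable two-jet.
-/
theorem metric_eventuallyEq (h : ContDiffAt ℝ 3 w.C (uOf x)) :
    w.metric =ᶠ[𝓝 x] fun y =>
      block (2 * ((w.P (zetaOf y))⁻¹ * (w.P (zetaOf y))⁻¹))
        (w.Q (zetaOf y) (uOf y) * (w.P (zetaOf y))⁻¹
          * (w.Q (zetaOf y) (uOf y) * (w.P (zetaOf y))⁻¹))
        (w.Q (zetaOf y) (uOf y) * (w.P (zetaOf y))⁻¹
          * (w.D (uOf y) * (w.Q (zetaOf y) (uOf y) * (w.P (zetaOf y))⁻¹) * (y 3 * y 3)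
            - 2 * (w.Qdot (zetaOf y) (uOf y) * (w.P (zetaOf y))⁻¹ * y 3)
            - w.H (zetaOf y) (uOf y))) := by
  have hc : ContinuousAt uOf x := (continuous_apply 2).continuousAt
  filter_upwards [hc.eventually (h.eventually (by simp))] with y hy
  rw [metric_eq_block, F_eq (hy.differentiableAt (by simp))]
  congr 1
  · ring
  · ring

theorem hasJet_P : HasJet (fun y => w.P (zetaOf y)) x ![2 * w.α * x 0, 2 * w.α * x 1, 0, 0]
    !![2 * w.α, 0, 0, 0; 0, 2 * w.α, 0, 0; 0, 0, 0, 0; 0, 0, 0, 0] := by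
  refine ((HasJet.const 1).add (hasJet_normSq_zetaOf.const_mul w.α)).cast (fun i => ?_)
    (fun i j => ?_)
  · fin_cases i <;> simp <;> ring
  · fin_cases i <;> fin_cases j <;> simp <;> ring

theorem hasJet_Q (h : ContDiffAt ℝ 2 w.C (uOf x)) :
    HasJet (fun y => w.Q (zetaOf y) (uOf y)) x
      ![2 * (w.ε * w.β * x 0 + (w.C (uOf x)).re), 2 * (w.ε * w.β * x 1 - (w.C (uOf x)).im),
        w.Qdot (zetaOf x) (uOf x), 0]
      !![2 * w.ε * w.β, 0, 2 * (deriv w.C (uOf x)).re, 0;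
        0, 2 * w.ε * w.β, -(2 * (deriv w.C (uOf x)).im), 0;
        2 * (deriv w.C (uOf x)).re, -(2 * (deriv w.C (uOf x)).im),
          2 * (deriv (deriv w.C) (uOf x) * zetaOf x).re, 0; 0, 0, 0, 0] := by
  refine (((((HasJet.const 1).add (hasJet_normSq_zetaOf.const_mul w.β)).mul
    (HasJet.const w.ε))).add (hasJet_re_mul h)).cast (fun i => ?_) (fun i j => ?_)
  · fin_cases i <;> simp [Qdot] <;> ring
  · fin_cases i <;> fin_cases j <;> simp <;> ring

theorem hasJet_Qdot (h : ContDiffAt ℝ 3 w.C (uOf x)) :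
    HasJet (fun y => w.Qdot (zetaOf y) (uOf y)) x
      ![2 * (deriv w.C (uOf x)).re, -(2 * (deriv w.C (uOf x)).im),
        2 * (deriv (deriv w.C) (uOf x) * zetaOf x).re, 0]
      !![0, 0, 2 * (deriv (deriv w.C) (uOf x)).re, 0;
        0, 0, -(2 * (deriv (deriv w.C) (uOf x)).im), 0;
        2 * (deriv (deriv w.C) (uOf x)).re, -(2 * (deriv (deriv w.C) (uOf x)).im),
          2 * (deriv (deriv (deriv w.C)) (uOf x) * zetaOf x).re, 0; 0, 0, 0, 0] :=
  hasJet_re_mul (contDiffAt_deriv (n := 2) (by simpa [two_add_one_eq_three] using h))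

/-- The curvature tensor of the metrics of the family. -/
theorem riemann_metric (h : w.RegularAt (zetaOf x) (uOf x)) (hε : w.ε = 0 ∨ w.ε = 1)
    {dH : Fin 4 → ℝ} {hH : Fin 4 → Fin 4 → ℝ}
    (HH : HasJet (fun y => w.H (zetaOf y) (uOf y)) x dH hH) (dH3 : dH 3 = 0)
    (hH3 : ∀ i, hH i 3 = 0) {P Q V p W l : ℝ} (hP : P = w.P (zetaOf x))
    (hQ : Q = w.Q (zetaOf x) (uOf x)) (hV : V = w.Qdot (zetaOf x) (uOf x) / P)
    (hp : p = 2 / P ^ 2) (hW : W = Q / P)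
    (hl : l = w.ε * (w.α + w.β) - 2 * w.α * W) (a b c d : Fin 4) :
    riemann w.metric x a b c d =
      curvForm (8 * w.α / P ^ 4)
        (W ^ 2 * (2 * Complex.normSq (w.C (uOf x)) - 2 * w.ε * w.β - 2 * w.α * W ^ 2
          + 2 * w.ε * (w.α + w.β) * W - w.D (uOf x)))
        (W * l * p)
        (-(W * (w.D (uOf x) * x 3 ^ 2 * l + 4 * w.α * x 3 * V)
            + (w.D (uOf x) * W * x 3 ^ 2 - 2 * V * x 3 - w.H (zetaOf x) (uOf x)) * l) / 2 * p
          + W / 2 * (hH 0 0 + 2 * w.α * (x 0 * dH 0 - x 1 * dH 1) / P))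
        (-(W * (w.D (uOf x) * x 3 ^ 2 * l + 4 * w.α * x 3 * V)
            + (w.D (uOf x) * W * x 3 ^ 2 - 2 * V * x 3 - w.H (zetaOf x) (uOf x)) * l) / 2 * p
          + W / 2 * (hH 1 1 + 2 * w.α * (x 1 * dH 1 - x 0 * dH 0) / P))
        (W / 2 * (hH 0 1 + 2 * w.α * (x 1 * dH 0 + x 0 * dH 1) / P)) a b c d := by
  have hP0 : P ≠ 0 := hP ▸ h.P_ne
  have hQ0 : Q ≠ 0 := hQ ▸ h.Q_ne
  have HP := (hasJet_P (w := w) (x := x)).inv h.P_ne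
  have HC2 : ContDiffAt ℝ 2 w.C (uOf x) := h.C_smooth.of_le (by norm_num)
  have HQ := hasJet_Q (w := w) (x := x) HC2
  have HV := hasJet_Qdot (w := w) (x := x) h.C_smooth
  have HD := hasJet_uOf_comp (x := x) h.D_smooth
  have hP' : P = 1 + w.α * (x 0 * x 0 + x 1 * x 1) := hP
  have hQ' : Q = (1 + w.β * (x 0 * x 0 + x 1 * x 1)) * w.ε
      + 2 * ((w.C (uOf x)).re * x 0 - (w.C (uOf x)).im * x 1) := by
    simp only [hQ, WaveData.Q]; simp [zetaOf, Complex.normSq_apply]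
  have hV' : w.Qdot (zetaOf x) (uOf x)
      = 2 * ((deriv w.C (uOf x)).re * x 0 - (deriv w.C (uOf x)).im * x 1) := by
    simp [Qdot, zetaOf]
  have hN : Complex.normSq (w.C (uOf x))
      = (w.C (uOf x)).re * (w.C (uOf x)).re + (w.C (uOf x)).im * (w.C (uOf x)).im := rfl
  rw [riemann_congr (metric_eventuallyEq h.C_smooth)]
  -- Here `l` and `μ` are the trace factors of the Hessians of `Q/P` and `Q_{,u}/P`, with `μ` the
  -- `u`-derivative of `l`. The constant `8α/P⁴` is the curvature `2α` of the surface times `p²`,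
  -- and `γ` is the squared gradient of `Q/P` divided by `p`.
  have key := riemann_warped (l := l) (μ := -2 * w.α * V) (c₁ := 8 * w.α / P ^ 4)
    (γ := 2 * Complex.normSq (w.C (uOf x)) - 2 * w.ε * w.β - 2 * w.α * W ^ 2
          + 2 * w.ε * (w.α + w.β) * W) ((HP.mul HP).const_mul 2) (HQ.mul HP) (HV.mul HP) HD HH
      (by simp [h.P_ne]) (by simp [h.P_ne, h.Q_ne]) (by simp) (by simp) (by simp) (by simp)
      (by simp) (by simp) (by simp) (by simp) dH3 (fun i => by fin_cases i <;> simp)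
      (fun i => by fin_cases i <;> simp) (fun i => by fin_cases i <;> simp)
      (fun i => by fin_cases i <;> simp) (fun i => by fin_cases i <;> simp)
      (fun i => by fin_cases i <;> simp) (fun i => by fin_cases i <;> simp) hH3
      (by simp) (by simp) ?_ ?_ ?_ ?_ ?_ ?_ ?_ ?_ a b c d
  · rw [key]
    simp only [← hP, ← hQ]
    simp
    congr 1 <;> simp only [hV, hW, hp] <;> field_simp <;> ring
  all_goals
    simp only [← hP, ← hQ, hV, hW, hl]
    simp
    field_simp
    -- The identity for `γ` is quadratic in `Q` and needs `ε² = ε`.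
    rcases hε with hε | hε <;> simp only [hN, hV', hε, hP', hQ'] <;> ring

end WaveData

/-! ### Tetrad components of block tensors and of `weylForm` -/

theorem contract2_block (a b c : ℝ) (X Y : Fin 4 → ℂ) :
    contract2 (block a b c) X Y =
      a * (X 0 * Y 0 + X 1 * Y 1) + c * (X 2 * Y 2) - b * (X 2 * Y 3 + X 3 * Y 2) := by
  simp [contract2, Fin.sum_univ_four, block]
  ring

section Tetrad

variable {P Q F : ℝ}

/-- The components of the tetrad vector `m`. -/
noncomputable def mVec (P : ℝ) : Fin 4 → ℂ := ![(P : ℂ) / 2, (P : ℂ) / 2 * Complex.I, 0, 0]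

/-- The components of the tetrad vector `l`. -/
noncomputable def lVec (P Q F : ℝ) : Fin 4 → ℝ :=
  ![0, 0, P ^ 2 / Q ^ 2, P ^ 4 / (2 * Q ^ 4) * F]

theorem toC_kVec : toC ![0, 0, 0, 1] = ![0, 0, 0, 1] := by
  ext i; fin_cases i <;> simp [toC]

theorem toC_lVec : toC (lVec P Q F) =
    ![0, 0, ((P ^ 2 / Q ^ 2 : ℝ) : ℂ), ((P ^ 4 / (2 * Q ^ 4) * F : ℝ) : ℂ)] := by
  ext i; fin_cases i <;> simp [toC, lVec]

theorem bar_mVec : bar (mVec P) = ![(P : ℂ) / 2, -((P : ℂ) / 2 * Complex.I), 0, 0] := by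
  ext i; fin_cases i <;> simp [bar, mVec, Complex.conj_ofNat]

theorem isNullTetrad_block (hP : P ≠ 0) (hQ : Q ≠ 0) :
    IsNullTetrad (block (2 / P ^ 2) (Q ^ 2 / P ^ 2) F) (mVec P) (lVec P Q F) ![0, 0, 0, 1] := by
  have hP' : (P : ℂ) ≠ 0 := Complex.ofReal_ne_zero.2 hP
  have hQ' : (Q : ℂ) ≠ 0 := Complex.ofReal_ne_zero.2 hQ
  constructor <;> rw [contract2_block] <;>
    (try simp only [bar_mVec]) <;> simp [toC_kVec, toC_lVec, mVec]
  · right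
    linear_combination ((P / 2) ^ 2 : ℂ) * Complex.I_mul_I
  · field_simp
    linear_combination (-1 : ℂ) * Complex.I_sq
  · field_simp
    ring
  · field_simp

variable {a b c ψ S t : ℝ}

section Ricci

theorem contract2_kk : contract2 (block a b c) (toC ![0, 0, 0, 1]) (toC ![0, 0, 0, 1]) = 0 := by
  rw [contract2_block]; simp [toC_kVec]

theorem contract2_km : contract2 (block a b c) (toC ![0, 0, 0, 1]) (mVec P) = 0 := by
  rw [contract2_block]; simp [toC_kVec, mVec]

theorem contract2_kmbar : contract2 (block a b c) (toC ![0, 0, 0, 1]) (bar (mVec P)) = 0 := by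
  rw [contract2_block]; simp [toC_kVec, bar_mVec]

theorem contract2_mm : contract2 (block a b c) (mVec P) (mVec P) = 0 := by
  rw [contract2_block]; simp [mVec]
  right
  linear_combination ((P / 2) ^ 2 : ℂ) * Complex.I_mul_I

theorem contract2_mbarmbar : contract2 (block a b c) (bar (mVec P)) (bar (mVec P)) = 0 := by
  rw [contract2_block]; simp [bar_mVec]
  right
  linear_combination ((P / 2) ^ 2 : ℂ) * Complex.I_mul_I

theorem contract2_lm : contract2 (block a b c) (toC (lVec P Q F)) (mVec P) = 0 := by
  rw [contract2_block]; simp [toC_lVec, mVec]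

theorem contract2_lmbar : contract2 (block a b c) (toC (lVec P Q F)) (bar (mVec P)) = 0 := by
  rw [contract2_block]; simp [toC_lVec, bar_mVec]

theorem contract2_kl : contract2 (block a b c) (toC ![0, 0, 0, 1]) (toC (lVec P Q F)) =
    (-(b * (P ^ 2 / Q ^ 2)) : ℝ) := by
  rw [contract2_block]; simp [toC_lVec, toC_kVec]

theorem contract2_mmbar : contract2 (block a b c) (mVec P) (bar (mVec P)) =
    (a * P ^ 2 / 2 : ℝ) := by
  rw [contract2_block, bar_mVec]; simp [mVec]
  linear_combination (-(a : ℂ) * (P / 2) ^ 2) * Complex.I_mul_I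

theorem contract2_ll : contract2 (block a b c) (toC (lVec P Q F)) (toC (lVec P Q F)) =
    (c * (P ^ 2 / Q ^ 2) ^ 2 - b * (P ^ 2 / Q ^ 2) * (P ^ 4 / Q ^ 4) * F : ℝ) := by
  rw [contract2_block]; simp [toC_lVec]
  ring

end Ricci

section Weyl

theorem contract4_weylForm_psi0 :
    contract4 (weylForm (2 / P ^ 2) (Q ^ 2 / P ^ 2) F ψ S t) (toC ![0, 0, 0, 1]) (mVec P)
      (toC ![0, 0, 0, 1]) (mVec P) = 0 := by
  rw [weylForm, contract4_curvForm]; simp [cwedge, toC_kVec, mVec]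

theorem contract4_weylForm_psi1 :
    contract4 (weylForm (2 / P ^ 2) (Q ^ 2 / P ^ 2) F ψ S t) (toC ![0, 0, 0, 1])
      (toC (lVec P Q F)) (toC ![0, 0, 0, 1]) (mVec P) = 0 := by
  rw [weylForm, contract4_curvForm]; simp [cwedge, toC_kVec, toC_lVec, mVec]

theorem contract4_weylForm_psi2 (hP : P ≠ 0) (hQ : Q ≠ 0) :
    contract4 (weylForm (2 / P ^ 2) (Q ^ 2 / P ^ 2) F ψ S t) (toC ![0, 0, 0, 1])
      (mVec P) (bar (mVec P)) (toC (lVec P Q F)) = ψ := by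
  have hP' : (P : ℂ) ≠ 0 := Complex.ofReal_ne_zero.2 hP
  have hQ' : (Q : ℂ) ≠ 0 := Complex.ofReal_ne_zero.2 hQ
  rw [weylForm, contract4_curvForm, bar_mVec]; simp [cwedge, toC_kVec, toC_lVec, mVec]
  field_simp
  linear_combination (-(ψ : ℂ)) * Complex.I_sq

theorem contract4_weylForm_psi3 :
    contract4 (weylForm (2 / P ^ 2) (Q ^ 2 / P ^ 2) F ψ S t) (toC ![0, 0, 0, 1])
      (toC (lVec P Q F)) (bar (mVec P)) (toC (lVec P Q F)) = 0 := by
  rw [weylForm, contract4_curvForm]; simp [cwedge, toC_kVec, toC_lVec, bar_mVec]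

/-- The terms in `ψ` cancel because `m̄` is null: they enter `T₀₂₀₂` and `T₁₂₁₂` equally. Only the
trace-free screen part `S`, `t` remains. -/
theorem contract4_weylForm_psi4 (hP : P ≠ 0) (hQ : Q ≠ 0) :
    contract4 (weylForm (2 / P ^ 2) (Q ^ 2 / P ^ 2) F ψ S t) (bar (mVec P))
      (toC (lVec P Q F)) (bar (mVec P)) (toC (lVec P Q F)) =
      (P ^ 6 / (2 * Q ^ 4) : ℝ) * (S - Complex.I * t) := by
  have hP' : (P : ℂ) ≠ 0 := Complex.ofReal_ne_zero.2 hP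
  have hQ' : (Q : ℂ) ≠ 0 := Complex.ofReal_ne_zero.2 hQ
  rw [weylForm, contract4_curvForm]; simp [cwedge, toC_lVec, bar_mVec]
  field_simp
  linear_combination (-((P : ℂ) ^ 2 * S)) * Complex.I_sq

end Weyl

end Tetrad

/-! ### Curvature scalars of the family and the congruence `∂_v` -/

namespace WaveData

variable {w : WaveData} {x : Coord}

theorem m_eq (x : Coord) : w.m x = mVec (w.P (zetaOf x)) := rfl

theorem l_eq (x : Coord) : w.l x =
    lVec (w.P (zetaOf x)) (w.Q (zetaOf x) (uOf x)) (w.F (zetaOf x) (uOf x) (vOf x)) := rfl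

theorem kField_eq (x : Coord) : kField x = ![0, 0, 0, 1] := rfl

variable (w) in
/-- The function `D + 2 ε β - 2 C C̄`. -/
noncomputable def defect (u : ℝ) : ℝ := w.D u + 2 * w.ε * w.β - 2 * Complex.normSq (w.C u)

variable (w) in
/-- The value of `Ψ₄`. -/
noncomputable def psi4 (ζ : ℂ) (u : ℝ) : ℂ :=
  (1 / 2) * dZeta (dZeta (fun z => ((w.P z * w.H z u : ℝ) : ℂ))) ζ
    * ((w.P ζ ^ 4 / w.Q ζ u ^ 3 : ℝ) : ℂ)

theorem isMetricInverse_metric (h : w.RegularAt (zetaOf x) (uOf x)) :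
    ∃ gi, IsMetricInverse w.metric gi x := by
  obtain ⟨dH, hH, HH, -, -⟩ := exists_hasJet_comp_zetaU (x := x) h.H_smooth
  have HP := (hasJet_P (w := w) (x := x)).inv h.P_ne
  have HQ := hasJet_Q (w := w) (x := x) (h.C_smooth.of_le (by norm_num))
  have HV := hasJet_Qdot (w := w) (x := x) h.C_smooth
  have HD := hasJet_uOf_comp (x := x) h.D_smooth
  have Hv := HasJet.coord (x := x) 3
  have HW := HQ.mul HP
  have key := isMetricInverse_block ((HP.mul HP).const_mul 2) (HW.mul HW)
    (HW.mul (((HD.mul HW).mul (Hv.mul Hv)).sub (((HV.mul HP).mul Hv).const_mul 2) |>.sub HH))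
    (by simp [h.P_ne]) (by simp [h.P_ne, h.Q_ne])
  have he := metric_eventuallyEq h.C_smooth
  refine ⟨_, ⟨fun i j => (key.smooth i j).congr_of_eventuallyEq
    (he.mono fun y hy => by simp only [hy]; rfl), ?_, ?_, key.differentiable⟩⟩
  · filter_upwards [he, key.symm] with y h1 h2 i j
    rw [h1]; exact h2 i j
  · filter_upwards [he, key.mul_eq_one] with y h1 h2
    rw [h1]; exact h2

/-- All curvature quantities of the metric at a regular point. -/
theorem curvature_metric (h : w.RegularAt (zetaOf x) (uOf x)) (hε : w.ε = 0 ∨ w.ε = 1)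
    {P Q F : ℝ} (hP : P = w.P (zetaOf x)) (hQ : Q = w.Q (zetaOf x) (uOf x))
    (hF : F = w.F (zetaOf x) (uOf x) (vOf x)) :
    (∀ a b c d, weyl w.metric x a b c d = weylForm (2 / P ^ 2) (Q ^ 2 / P ^ 2) F
      (-(1 / 6) * w.defect (uOf x) * (P ^ 2 / Q ^ 2))
      (2 * Q ^ 4 / P ^ 6 * (w.psi4 (zetaOf x) (uOf x)).re)
      (-(2 * Q ^ 4 / P ^ 6 * (w.psi4 (zetaOf x) (uOf x)).im)) a b c d) ∧
    scalarCurv w.metric x = 24 * w.α - 12 * w.ε * (w.α + w.β) * (P / Q)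
      + 2 * w.defect (uOf x) * (P ^ 2 / Q ^ 2) ∧
    ∃ a b c : ℝ, traceFreeRicci w.metric x = block a b c ∧
      -(b * (P ^ 2 / Q ^ 2)) + a * P ^ 2 / 2 = 2 * w.ε * (w.α + w.β) * (P / Q)
        - w.defect (uOf x) * (P ^ 2 / Q ^ 2) ∧
      ((c * (P ^ 2 / Q ^ 2) ^ 2 - b * (P ^ 2 / Q ^ 2) * (P ^ 4 / Q ^ 4) * F : ℝ) : ℂ) =
        ((((w.ε * (w.α - w.β) * (1 - w.α * Complex.normSq (zetaOf x))
                + 2 * w.α * (2 * (w.C (uOf x) * zetaOf x).re)) * w.H (zetaOf x) (uOf x) : ℝ) : ℂ)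
            + ((P ^ 2 * Q : ℝ) : ℂ)
              * dZeta (dZetaBar (fun z => ((w.H z (uOf x) : ℝ) : ℂ))) (zetaOf x)
            - ((2 * w.ε * (w.α + w.β) * vOf x * (2 * (deriv w.C (uOf x) * zetaOf x).re) : ℝ) : ℂ))
          * ((P ^ 3 / Q ^ 4 : ℝ) : ℂ) := by
  have hP0 : P ≠ 0 := hP ▸ h.P_ne
  have hQ0 : Q ≠ 0 := hQ ▸ h.Q_ne
  have hp0 : 2 / P ^ 2 ≠ 0 := by positivity
  have hq0 : Q ^ 2 / P ^ 2 ≠ 0 := by positivity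
  obtain ⟨dH, hH, HH, dH3, hH3⟩ := exists_hasJet_comp_zetaU (x := x) h.H_smooth
  have hPs : ContDiffAt ℝ 2 (fun q : ℂ × ℝ => w.P q.1 * w.H q.1 q.2) (zetaU x) := by
    refine ContDiffAt.mul ?_ h.H_smooth
    have h1 : ContDiff ℝ 2 (fun q : ℂ × ℝ => 1 + w.α * (q.1.re * q.1.re + q.1.im * q.1.im)) :=
      contDiff_const.add (contDiff_const.mul
        (((Complex.reCLM.contDiff.comp contDiff_fst).mul
          (Complex.reCLM.contDiff.comp contDiff_fst)).add
        ((Complex.imCLM.contDiff.comp contDiff_fst).mul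
          (Complex.imCLM.contDiff.comp contDiff_fst))))
    exact h1.contDiffAt
  -- Since `P_xx = P_yy` and `P_xy = 0`, second derivatives of `P` drop out. What is left is `P`
  -- times the combinations of derivatives of `H` found in the trace-free screen part of the
  -- curvature.
  have e4 : dZeta (dZeta (fun z => ((w.P z * w.H z (uOf x) : ℝ) : ℂ))) (zetaOf x) =
      (1 / 4) * ((P * (hH 0 0 - hH 1 1) + 4 * w.α * (x 0 * dH 0 - x 1 * dH 1) : ℝ)
        - 2 * Complex.I * (2 * w.α * (x 1 * dH 0 + x 0 * dH 1) + P * hH 0 1 : ℝ)) :=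
    (dZeta_dZeta_eq (x := x) hPs ((hasJet_P (w := w) (x := x)).mul HH)).trans (by
      rw [hP]; simp; ring)
  have e2 : dZeta (dZetaBar (fun z => ((w.H z (uOf x) : ℝ) : ℂ))) (zetaOf x) =
      ((1 / 4 * (hH 0 0 + hH 1 1) : ℝ) : ℂ) :=
    (dZeta_dZetaBar_eq (x := x) h.H_smooth HH).trans (by push_cast; ring)
  have hR := riemann_metric h hε HH dH3 hH3 hP hQ rfl rfl rfl rfl
  have hg : w.metric x = block (2 / P ^ 2) (Q ^ 2 / P ^ 2) F := by rw [hP, hQ, hF]; rfl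
  obtain ⟨gi, hgi⟩ := isMetricInverse_metric h
  have hr := ricci_of_block hp0 hq0 hg hR hgi.ricci_eq
  have hs := scalarCurv_of_block hp0 hq0 hg hr
  have hw := weyl_of_block hp0 hq0 hg hR hr
  have hF' : F = Q * P⁻¹ * (w.D (uOf x) * (Q * P⁻¹) * (vOf x * vOf x)
      - 2 * (w.Qdot (zetaOf x) (uOf x) * P⁻¹ * vOf x) - w.H (zetaOf x) (uOf x)) := by
    rw [hF, hP, hQ, F_eq (h.C_smooth.differentiableAt (by simp))]
  have hscal : scalarCurv w.metric x = 24 * w.α - 12 * w.ε * (w.α + w.β) * (P / Q)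
      + 2 * w.defect (uOf x) * (P ^ 2 / Q ^ 2) := by
    rw [hs, defect]
    field_simp
    ring
  refine ⟨fun a b c d => ?_, hscal, ?_⟩
  · have hψ : w.psi4 (zetaOf x) (uOf x) = (1 / 8 : ℝ) * ((P * (hH 0 0 - hH 1 1)
        + 4 * w.α * (x 0 * dH 0 - x 1 * dH 1) : ℝ)
        - 2 * Complex.I * (2 * w.α * (x 1 * dH 0 + x 0 * dH 1) + P * hH 0 1 : ℝ))
        * (P ^ 4 / Q ^ 3 : ℝ) := by
      rw [psi4, e4, ← hP, ← hQ]
      push_cast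
      ring
    have hre : (w.psi4 (zetaOf x) (uOf x)).re = 1 / 8 * (P * (hH 0 0 - hH 1 1)
        + 4 * w.α * (x 0 * dH 0 - x 1 * dH 1)) * (P ^ 4 / Q ^ 3) := by
      rw [hψ, Complex.re_mul_ofReal, Complex.re_ofReal_mul]; simp
    have him : (w.psi4 (zetaOf x) (uOf x)).im =
        -(1 / 4) * (2 * w.α * (x 1 * dH 0 + x 0 * dH 1) + P * hH 0 1) * (P ^ 4 / Q ^ 3) := by
      rw [hψ, Complex.im_mul_ofReal, Complex.im_ofReal_mul]
      simp [-mul_eq_mul_right_iff]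
      ring
    rw [hw, hre, him, defect]
    congr 1
    · field_simp
      ring
    · field_simp
      ring
    · field_simp
      ring
  · refine ⟨_, _, _, traceFreeRicci_of_block hg hr, ?_, ?_⟩
    · rw [hscal, defect]
      field_simp
      ring
    · have hP' : P = 1 + w.α * Complex.normSq (zetaOf x) := hP
      have hQ' : Q = (1 + w.β * Complex.normSq (zetaOf x)) * w.ε
        + 2 * (w.C (uOf x) * zetaOf x).re := hQ
      -- The right-hand side is `-P l`, with `l` the trace factor of the Hessian of `Q/P`; this is
      -- the form in which the coefficient of `H` leaves the curvature tensor.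
      have hc : w.ε * (w.α - w.β) * (1 - w.α * Complex.normSq (zetaOf x))
          + 2 * w.α * (2 * (w.C (uOf x) * zetaOf x).re) =
          2 * w.α * Q - w.ε * (w.α + w.β) * P := by
        rw [hP', hQ']; ring
      have hV : 2 * (deriv w.C (uOf x) * zetaOf x).re = w.Qdot (zetaOf x) (uOf x) := rfl
      have hv : vOf x = x 3 := rfl
      rw [hc, hV, hscal, defect]
      rw [e2, ← Complex.ofReal_mul, ← Complex.ofReal_add, ← Complex.ofReal_sub,
        ← Complex.ofReal_mul, Complex.ofReal_inj, hF', hv]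
      field_simp
      ring

theorem pderiv_metric (h : w.RegularAt (zetaOf x) (uOf x)) :
    ∃ dp dq dF : Fin 4 → ℝ, (∀ k a b, pderiv k (fun z => w.metric z a b) x =
      block (dp k) (dq k) (dF k) a b) ∧ dp 3 = 0 ∧ dq 3 = 0 := by
  obtain ⟨dH, hH, HH, -, -⟩ := exists_hasJet_comp_zetaU (x := x) h.H_smooth
  have HP := (hasJet_P (w := w) (x := x)).inv h.P_ne
  have HQ := hasJet_Q (w := w) (x := x) (h.C_smooth.of_le (by norm_num))
  have HV := hasJet_Qdot (w := w) (x := x) h.C_smooth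
  have HD := hasJet_uOf_comp (x := x) h.D_smooth
  have Hv := HasJet.coord (x := x) 3
  have HW := HQ.mul HP
  have key := hasJet_block ((HP.mul HP).const_mul 2) (HW.mul HW)
    (HW.mul (((HD.mul HW).mul (Hv.mul Hv)).sub (((HV.mul HP).mul Hv).const_mul 2) |>.sub HH))
  refine ⟨_, _, _, fun k a b => (pderiv_congr ?_ k).trans ((key a b).grad k), by simp, by simp⟩
  exact (metric_eventuallyEq h.C_smooth).mono fun y hy => by simp only [hy]; rfl

/-- The components of `∂_v` are constant, so the covariant derivative is the Christoffel symbol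
`Γ_{a,b3}`. As `p` and `q` do not depend on `v`, every remaining entry has an index along `u`. -/
theorem covDerivLower_kField (h : w.RegularAt (zetaOf x) (uOf x)) :
    ∃ dq : Fin 4 → ℝ, ∃ f : ℝ, ∀ a b, covDerivLower w.metric kField x a b =
      !![0, 0, dq 0, 0; 0, 0, dq 1, 0; -dq 0, -dq 1, f, 0; 0, 0, 0, 0] a b := by
  obtain ⟨gi, hgi⟩ := isMetricInverse_metric h
  obtain ⟨dp, dq, dF, hd, hp3, hq3⟩ := pderiv_metric h
  refine ⟨fun i => dq i / 2, dF 3 / 2, fun a b => ?_⟩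
  have hk : ∀ c, pderiv b (fun y => kField y c) x = 0 := by
    intro c
    simp [pderiv, kField]
  have hcov : covDerivLower w.metric kField x a b =
      ∑ c, w.metric x a c * christoffel w.metric x c b 3 := by
    refine Finset.sum_congr rfl fun c _ => ?_
    rw [hk]
    simp [Fin.sum_univ_four, kField]
  rw [hcov, hgi.sum_mul_christoffel.self_of_nhds, christoffelLower]
  simp only [hd]
  fin_cases a <;> fin_cases b <;> simp [block, hp3, hq3] <;> ring

theorem spin_coefficients (h : w.RegularAt (zetaOf x) (uOf x)) :
    spinRho w.metric w.m kField x = 0 ∧ spinSigma w.metric w.m kField x = 0 ∧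
      spinKappa w.metric w.m kField x = 0 := by
  obtain ⟨dq, f, hc⟩ := covDerivLower_kField h
  simp [spinRho, spinSigma, spinKappa, contract2, Fin.sum_univ_four, hc, m, kField, toC, bar]

theorem isKundtCongruence {S : Set (ℂ × ℝ)}
    (h : ∀ q ∈ S, w.RegularAt q.1 q.2) : IsKundtCongruence w.metric (domainOver S) kField := by
  -- Orthogonality to `k = ∂_v` means vanishing `u`-component, since `g(k, X) = -q X²` with `X²` the
  -- component of index 2. All optical quantities therefore vanish together.
  have hscreen : ∀ x ∈ domainOver S, ∀ e₁ e₂, IsScreen (w.metric x) (kField x) e₁ e₂ →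
      ∀ X ∈ ({e₁, e₂} : Set (Fin 4 → ℝ)), X 2 = 0 := by
    intro x hx e₁ e₂ he X hX
    have hq : w.Q (zetaOf x) (uOf x) ^ 2 / w.P (zetaOf x) ^ 2 ≠ 0 :=
      div_ne_zero (pow_ne_zero 2 (h _ hx).Q_ne) (pow_ne_zero 2 (h _ hx).P_ne)
    have hk : bilin (w.metric x) (kField x) X = 0 := by
      rcases hX with rfl | hX
      · exact he.2.2.2.1
      · rw [Set.mem_singleton_iff.1 hX]; exact he.2.2.2.2
    simp only [metric_eq_block] at hk
    generalize w.Q (zetaOf x) (uOf x) ^ 2 / w.P (zetaOf x) ^ 2 = q at hk hq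
    simpa [bilin, Fin.sum_univ_four, block, kField, hq] using hk
  have hbil : ∀ x ∈ domainOver S, ∀ e₁ e₂, IsScreen (w.metric x) (kField x) e₁ e₂ →
      ∀ X ∈ ({e₁, e₂} : Set (Fin 4 → ℝ)), ∀ Y ∈ ({e₁, e₂} : Set (Fin 4 → ℝ)),
        bilin (covDerivLower w.metric kField x) X Y = 0 := by
    intro x hx e₁ e₂ he X hX Y hY
    obtain ⟨dq, f, hc⟩ := covDerivLower_kField (h _ hx)
    simp [bilin, Fin.sum_univ_four, hc, hscreen x hx e₁ e₂ he X hX, hscreen x hx e₁ e₂ he Y hY]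
  refine ⟨contDiffOn_const, fun x _ h0 => ?_, fun x _ => ?_, fun x hx => ⟨0, fun a => ?_⟩,
    fun x hx e₁ e₂ he => ?_, fun x hx e₁ e₂ he => ?_, fun x hx e₁ e₂ he => ?_⟩
  · simpa [kField] using congrFun h0 3
  · simp [bilin, Fin.sum_univ_four, metric_eq_block, block, kField]
  · obtain ⟨dq, f, hc⟩ := covDerivLower_kField (h _ hx)
    fin_cases a <;> simp [Fin.sum_univ_four, hc, kField]
  all_goals
    have h1 := hbil x hx e₁ e₂ he
    simp [h1 e₁ (by simp) e₁ (by simp), h1 e₁ (by simp) e₂ (by simp),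
      h1 e₂ (by simp) e₁ (by simp), h1 e₂ (by simp) e₂ (by simp)]

end WaveData

/-! ### Real functions with vanishing second `ζ`-derivative -/

/-- A real-valued holomorphic function on a connected open set is constant. -/
theorem exists_const_of_holomorphic_of_im_eq_zero {U : Set ℂ} (hU : IsOpen U)
    (hc : IsPreconnected U) {g : ℂ → ℂ} (hg : DifferentiableOn ℂ g U)
    (him : ∀ z ∈ U, (g z).im = 0) : ∃ A : ℝ, ∀ z ∈ U, g z = A := by
  have hderiv : U.EqOn (deriv g) 0 := by
    intro z hz
    have hd := (hg.differentiableAt (hU.mem_nhds hz)).hasDerivAt.complexToReal_fderiv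
    have h1 := (Complex.imCLM.hasFDerivAt (x := g z)).comp z hd
    have h2 : Complex.imCLM ∘ g =ᶠ[𝓝 z] fun _ => (0 : ℝ) := by
      filter_upwards [hU.mem_nhds hz] with y hy using him y hy
    have h3 := h1.unique ((hasFDerivAt_const (0 : ℝ) z).congr_of_eventuallyEq h2)
    -- The directions `1` and `i` give the imaginary and the real part of the derivative.
    have e1 := DFunLike.congr_fun h3 1
    have e2 := DFunLike.congr_fun h3 Complex.I
    simp at e1 e2
    exact Complex.ext e2 e1
  obtain ⟨a, ha⟩ := hU.exists_is_const_of_deriv_eq_zero hc hg hderiv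
  refine ⟨a.re, fun z hz => ?_⟩
  have h1 := him z hz
  rw [ha z hz] at h1 ⊢
  exact Complex.ext rfl h1

theorem hasFDerivAt_quadratic (A : ℝ) (B z : ℂ) :
    HasFDerivAt (fun z : ℂ => 2 * (B * z).re + A * Complex.normSq z)
      ((2 * (A * z.re + B.re)) • Complex.reCLM + (2 * (A * z.im - B.im)) • Complex.imCLM) z := by
  have h1 := Complex.reCLM.hasFDerivAt (x := z)
  have h2 := Complex.imCLM.hasFDerivAt (x := z)
  have h := (((h1.const_mul B.re).sub (h2.const_mul B.im)).const_mul 2).add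
    (((h1.mul h1).add (h2.mul h2)).const_mul A)
  refine (h.congr_fderiv ?_).congr_of_eventuallyEq (Eventually.of_forall fun y => ?_)
  · ext
    simp
    ring
  · simp [Complex.normSq_apply]

section Slice

variable {f : ℂ × ℝ → ℝ} {z : ℂ} {u : ℝ}

theorem fderiv_fderiv_of_dZeta_dZeta_eq_zero (hf : ContDiffAt ℝ 2 f (z, u))
    (h0 : dZeta (dZeta fun z => (f (z, u) : ℂ)) z = 0) :
    fderiv ℝ (fun q => fderiv ℝ f q (1, 0)) (z, u) (1, 0) =
        fderiv ℝ (fun q => fderiv ℝ f q (Complex.I, 0)) (z, u) (Complex.I, 0) ∧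
      fderiv ℝ (fun q => fderiv ℝ f q (Complex.I, 0)) (z, u) (1, 0) = 0 ∧
      fderiv ℝ (fun q => fderiv ℝ f q (1, 0)) (z, u) (Complex.I, 0) = 0 := by
  -- The fourth coordinate `0` is a filler: `zetaU` ignores `v`.
  have hf' : ContDiffAt ℝ 2 f (zetaU ![z.re, z.im, u, 0]) := hf
  have H := HasJet.of_contDiffAt (contDiffAt_comp_zetaU hf')
  have h1 := dZeta_dZeta_eq hf' H
  have h2 := H.symm 1 0
  simp only [pderiv_pderiv_comp_zetaU hf', zetaU_single_zero, zetaU_single_one] at h1 h2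
  rw [show zetaU ![z.re, z.im, u, 0] = (z, u) from rfl] at h1 h2
  rw [show zetaOf ![z.re, z.im, u, 0] = z from rfl, show uOf ![z.re, z.im, u, 0] = u from rfl,
    h0] at h1
  have e1 := congrArg Complex.re h1
  have e2 := congrArg Complex.im h1
  simp at e1 e2
  exact ⟨by linarith, e2, h2.trans e2⟩

/-- For real `f`, conjugating `f_{,ζζ} = 0` gives the Cauchy–Riemann equations for `h = f_{,ζ̄}`.
Its derivative `f_{,ζζ̄}` is real, hence a constant `A` on the connected set, so `h = Aζ + B`.
Integrating once more gives `f = a + 2 Re(B̄ ζ) + A ζζ̄`. -/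
theorem exists_quadratic_of_dZeta_dZeta_eq_zero {U : Set ℂ} (hU : IsOpen U)
    (hc : IsPreconnected U) (hf : ∀ z ∈ U, ContDiffAt ℝ 2 f (z, u))
    (h0 : ∀ z ∈ U, dZeta (dZeta fun z => (f (z, u) : ℂ)) z = 0) :
    ∃ (A₀ A₂ : ℝ) (A₁ : ℂ), ∀ z ∈ U,
      f (z, u) = A₀ + 2 * (A₁ * z).re + A₂ * Complex.normSq z := by
  set h : ℂ → ℂ := fun z => (1 / 2) * ((fderiv ℝ f (z, u) (1, 0) : ℝ)
    + Complex.I * (fderiv ℝ f (z, u) (Complex.I, 0) : ℝ)) with hh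
  have hd : ∀ z ∈ U, HasDerivAt h
      ((1 / 2 * fderiv ℝ (fun q => fderiv ℝ f q (1, 0)) (z, u) (1, 0) : ℝ) : ℂ) z := by
    intro z hz
    have h1 := differentiableAt_fderiv_apply (hf z hz) (1, 0)
    have h2 := differentiableAt_fderiv_apply (hf z hz) (Complex.I, 0)
    have e1 := (hasFDerivAt_slice h1).differentiableAt
    have e2 := (hasFDerivAt_slice h2).differentiableAt
    have hfd : ∀ v, fderiv ℝ h z v = (1 / 2) *
        ((fderiv ℝ (fun q => fderiv ℝ f q (1, 0)) (z, u) (v, 0) : ℝ)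
          + Complex.I * (fderiv ℝ (fun q => fderiv ℝ f q (Complex.I, 0)) (z, u) (v, 0) : ℝ)) := by
      intro v
      rw [hh, fderiv_ofReal_add_mul e1 e2, fderiv_slice h1, fderiv_slice h2]
    obtain ⟨r1, r2, r3⟩ := fderiv_fderiv_of_dZeta_dZeta_eq_zero (hf z hz) (h0 z hz)
    have hdiff : DifferentiableAt ℝ h z :=
      (((Complex.ofRealCLM.differentiableAt).comp z e1).add
        (((Complex.ofRealCLM.differentiableAt).comp z e2).const_mul Complex.I)).const_mul (1 / 2)
    -- The Cauchy–Riemann equation for `h` is exactly `f_xx = f_yy` together with vanishing mixed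
    -- derivatives.
    have key := complexOfReal_hasDerivAt hdiff (by
      rw [hfd, hfd, r2, r3, r1]; simp; ring)
    refine key.congr_deriv ?_
    change fderiv ℝ h z 1 = _
    rw [hfd, r2]
    simp
  have hdo : DifferentiableOn ℂ h U :=
    fun z hz => (hd z hz).differentiableAt.differentiableWithinAt
  obtain ⟨A, hA⟩ := exists_const_of_holomorphic_of_im_eq_zero hU hc (hdo.deriv hU)
    (fun z hz => by rw [(hd z hz).deriv, Complex.ofReal_im])
  obtain ⟨B, hB⟩ := hU.exists_eq_add_of_deriv_eq hc hdo
    (g := fun z => (A : ℂ) * z) (differentiableOn_id.const_mul _) (fun z hz => by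
      rw [hA z hz, ((hasDerivAt_id' z).const_mul (A : ℂ)).deriv, mul_one])
  obtain ⟨a, ha⟩ := hU.exists_eq_add_of_fderiv_eq (𝕜 := ℝ) hc (f := fun z => f (z, u))
    (g := fun z => 2 * ((starRingEnd ℂ) B * z).re + A * Complex.normSq z)
    (fun z hz => (hasFDerivAt_slice
      ((hf z hz).differentiableAt (by simp))).differentiableAt.differentiableWithinAt)
    (fun z _ => (hasFDerivAt_quadratic A _ z).differentiableAt.differentiableWithinAt)
    (fun z hz => by
      have hz' := hB hz
      have e1 := congrArg Complex.re hz'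
      have e2 := congrArg Complex.im hz'
      simp [hh] at e1 e2
      rw [(hasFDerivAt_quadratic A _ z).fderiv]
      ext y
      rw [fderiv_slice ((hf z hz).differentiableAt (by simp)),
        show (y, (0 : ℝ)) = y.re • ((1 : ℂ), (0 : ℝ)) + y.im • (Complex.I, (0 : ℝ)) by
          ext <;> simp, map_add, map_smul, map_smul]
      simp
      linear_combination 2 * y.re * e1 + 2 * y.im * e2)
  refine ⟨a, A, (starRingEnd ℂ) B, fun z hz => ?_⟩
  rw [show f (z, u) = _ from ha hz]
  ring

end Slice

theorem dZeta_dZeta_quadratic (A₀ A₂ : ℝ) (A₁ ζ : ℂ) :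
    dZeta (dZeta fun z =>
      ((A₀ + 2 * (A₁ * z).re + A₂ * Complex.normSq z : ℝ) : ℂ)) ζ = 0 := by
  let x : Coord := ![ζ.re, ζ.im, 0, 0]
  have H := ((HasJet.const (x := x) A₀).add (hasJet_re_mul (φ := fun _ => A₁)
    contDiffAt_const)).add (hasJet_normSq_zetaOf.const_mul A₂)
  have hf : ContDiffAt ℝ 2 (fun q : ℂ × ℝ =>
      A₀ + 2 * (A₁ * q.1).re + A₂ * Complex.normSq q.1) (zetaU x) := by
    have h1 : ContDiff ℝ 2 (fun q : ℂ × ℝ => A₀ + 2 * (A₁ * q.1).re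
        + A₂ * (q.1.re * q.1.re + q.1.im * q.1.im)) :=
      (contDiff_const.add (contDiff_const.mul
        (Complex.reCLM.contDiff.comp (contDiff_const.mul contDiff_fst)))).add
      (contDiff_const.mul (((Complex.reCLM.contDiff.comp contDiff_fst).mul
          (Complex.reCLM.contDiff.comp contDiff_fst)).add
        ((Complex.imCLM.contDiff.comp contDiff_fst).mul
          (Complex.imCLM.contDiff.comp contDiff_fst))))
    exact h1.contDiffAt
  have key := dZeta_dZeta_eq hf H
  rw [show zetaOf x = ζ from rfl] at key
  exact key.trans (by simp)

/-- The second derivative `∂²f/∂ζ²` of a `C²` function is continuous. -/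
theorem continuousAt_dZeta_dZeta {f : ℂ × ℝ → ℝ} {x : Coord} (hf : ContDiffAt ℝ 2 f (zetaU x)) :
    ContinuousAt (fun y => dZeta (dZeta fun z => (f (z, uOf y) : ℂ)) (zetaOf y)) x := by
  have hs := contDiffAt_comp_zetaU hf
  have hc : ∀ i j, ContinuousAt (pderiv i (pderiv j fun y => f (zetaU y))) x := fun i j =>
    (contDiffAt_pderiv (n := 0)
      (contDiffAt_pderiv (n := 1) (by simpa [one_add_one_eq_two] using hs) j) i).continuousAt
  refine ContinuousAt.congr (f := fun y => (1 / 4 : ℂ) *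
    ((pderiv 0 (pderiv 0 fun y => f (zetaU y)) y - pderiv 1 (pderiv 1 fun y => f (zetaU y)) y : ℝ)
      - 2 * Complex.I * (pderiv 0 (pderiv 1 fun y => f (zetaU y)) y : ℝ))) ?_ ?_
  · exact continuousAt_const.mul
      ((Complex.continuous_ofReal.continuousAt.comp ((hc 0 0).sub (hc 1 1))).sub
        (continuousAt_const.mul (Complex.continuous_ofReal.continuousAt.comp (hc 0 1))))
  · filter_upwards [zetaU.continuous.continuousAt.eventually (hf.eventually (by simp))] with y hy
    exact (dZeta_dZeta_eq hy (HasJet.of_contDiffAt (contDiffAt_comp_zetaU hy))).symm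

/-! ### The zero set of `Ψ₄`, the scalars and the Petrov types of the family -/

namespace WaveData

variable {w : WaveData} {S : Set (ℂ × ℝ)}

theorem contDiffAt_P_mul_H {ζ : ℂ} {u : ℝ} (h : w.RegularAt ζ u) :
    ContDiffAt ℝ 2 (fun q : ℂ × ℝ => w.P q.1 * w.H q.1 q.2) (ζ, u) := by
  refine ContDiffAt.mul ?_ h.H_smooth
  have h1 : ContDiff ℝ 2 (fun q : ℂ × ℝ => 1 + w.α * (q.1.re * q.1.re + q.1.im * q.1.im)) :=
    contDiff_const.add (contDiff_const.mul
      (((Complex.reCLM.contDiff.comp contDiff_fst).mul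
        (Complex.reCLM.contDiff.comp contDiff_fst)).add
      ((Complex.imCLM.contDiff.comp contDiff_fst).mul
        (Complex.imCLM.contDiff.comp contDiff_fst))))
  exact h1.contDiffAt

theorem psi4_eq_zero_iff {ζ : ℂ} {u : ℝ} (h : w.RegularAt ζ u) :
    w.psi4 ζ u = 0 ↔ dZeta (dZeta fun z => ((w.P z * w.H z u : ℝ) : ℂ)) ζ = 0 := by
  simp [psi4, h.P_ne, h.Q_ne]

theorem psi4_eq_zero_of_isH₀ (hS : IsOpen S) (h : ∀ q ∈ S, w.RegularAt q.1 q.2)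
    (hH : w.IsH₀ S) {ζ : ℂ} {u : ℝ} (hq : (ζ, u) ∈ S) : w.psi4 ζ u = 0 := by
  obtain ⟨A₀, A₂, A₁, hA⟩ := hH
  rw [psi4_eq_zero_iff (h _ hq), ← dZeta_dZeta_quadratic (A₀ u) (A₂ u) (A₁ u) ζ]
  have hev : ∀ᶠ z in 𝓝 ζ, (z, u) ∈ S :=
    (Continuous.prodMk_left u).continuousAt.eventually (hS.mem_nhds hq)
  -- Two derivatives are taken, so the two functions must agree near every point close to `ζ`.
  refine dZeta_congr (hev.eventually_nhds.mono fun z hz => dZeta_congr (hz.mono fun y hy => ?_))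
  have hP : 1 + w.α * Complex.normSq y ≠ 0 := (h _ hy).P_ne
  have hy' := hA _ hy
  simp only at hy' ⊢
  rw [hy', P, mul_div_cancel₀ _ hP]

/-- The integration constants are chosen slice by slice; `IsH₀` asks for no regularity in `u`, and
an empty slice is preconnected. -/
theorem isH₀_of_psi4_eq_zero (hS : IsOpen S) (h : ∀ q ∈ S, w.RegularAt q.1 q.2)
    (hc : ∀ u, IsPreconnected {ζ : ℂ | (ζ, u) ∈ S}) (h0 : ∀ q ∈ S, w.psi4 q.1 q.2 = 0) :
    w.IsH₀ S := by
  have key : ∀ u : ℝ, ∃ (A₀ A₂ : ℝ) (A₁ : ℂ), ∀ z ∈ {ζ : ℂ | (ζ, u) ∈ S},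
      w.P z * w.H z u = A₀ + 2 * (A₁ * z).re + A₂ * Complex.normSq z := fun u =>
    exists_quadratic_of_dZeta_dZeta_eq_zero (f := fun q : ℂ × ℝ => w.P q.1 * w.H q.1 q.2)
      (hS.preimage (Continuous.prodMk_left u)) (hc u) (fun z hz => contDiffAt_P_mul_H (h _ hz))
      (fun z hz => (psi4_eq_zero_iff (h _ hz)).1 (h0 _ hz))
  choose A₀ A₂ A₁ hA using key
  refine ⟨A₀, A₂, A₁, fun q hq => ?_⟩
  rw [← hA q.2 q.1 hq, ← P, mul_div_cancel_left₀ _ (h q hq).P_ne]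

theorem isOpen_psi4_ne_zero (hS : IsOpen S) (h : ∀ q ∈ S, w.RegularAt q.1 q.2) :
    IsOpen {x | x ∈ domainOver S ∧ w.psi4 (zetaOf x) (uOf x) ≠ 0} := by
  refine isOpen_iff_mem_nhds.2 fun x hx => ?_
  have h0 := (psi4_eq_zero_iff (h _ hx.1)).not.1 hx.2
  have hd := (isOpen_domainOver hS).mem_nhds hx.1
  filter_upwards [hd, (continuousAt_dZeta_dZeta (x := x)
    (contDiffAt_P_mul_H (h _ hx.1))).eventually_ne h0] with y hy hy'
  exact ⟨hy, (psi4_eq_zero_iff (h _ hy)).not.2 hy'⟩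

theorem regularAt_of_contDiffOn (hS : IsOpen S)
    (hP : ∀ q ∈ S, w.P q.1 ≠ 0) (hQ : ∀ q ∈ S, w.Q q.1 q.2 ≠ 0)
    (hC : ContDiffOn ℝ 3 w.C (Prod.snd '' S)) (hD : ContDiffOn ℝ 2 w.D (Prod.snd '' S))
    (hH : ContDiffOn ℝ 2 (fun q : ℂ × ℝ => w.H q.1 q.2) S) :
    ∀ q ∈ S, w.RegularAt q.1 q.2 := fun q hq =>
  have hn : Prod.snd '' S ∈ 𝓝 q.2 :=
    (isOpenMap_snd S hS).mem_nhds (Set.mem_image_of_mem _ hq)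
  ⟨hP q hq, hQ q hq, hC.contDiffAt hn, hD.contDiffAt hn, hH.contDiffAt (hS.mem_nhds hq)⟩

theorem isNullTetrad (h : w.RegularAt (zetaOf x) (uOf x)) :
    IsNullTetrad (w.metric x) (w.m x) (w.l x) (kField x) := by
  rw [metric_eq_block, m_eq, l_eq, kField_eq]
  exact isNullTetrad_block h.P_ne h.Q_ne

theorem weyl_metric (h : w.RegularAt (zetaOf x) (uOf x)) (hε : w.ε = 0 ∨ w.ε = 1) :
    weyl w.metric x = weylForm (2 / w.P (zetaOf x) ^ 2)
      (w.Q (zetaOf x) (uOf x) ^ 2 / w.P (zetaOf x) ^ 2) (w.F (zetaOf x) (uOf x) (vOf x))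
      (-(1 / 6) * w.defect (uOf x) * (w.P (zetaOf x) ^ 2 / w.Q (zetaOf x) (uOf x) ^ 2))
      (2 * w.Q (zetaOf x) (uOf x) ^ 4 / w.P (zetaOf x) ^ 6 * (w.psi4 (zetaOf x) (uOf x)).re)
      (-(2 * w.Q (zetaOf x) (uOf x) ^ 4 / w.P (zetaOf x) ^ 6
        * (w.psi4 (zetaOf x) (uOf x)).im)) := by
  funext a b c d
  exact (curvature_metric h hε rfl rfl rfl).1 a b c d

theorem Psi_vanish (h : w.RegularAt (zetaOf x) (uOf x)) (hε : w.ε = 0 ∨ w.ε = 1) :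
    Psi0 w.metric w.m kField x = 0 ∧ Psi1 w.metric w.m w.l kField x = 0 ∧
      Psi3 w.metric w.m w.l kField x = 0 := by
  rw [Psi0, Psi1, Psi3, weyl_metric h hε, m_eq, l_eq, kField_eq]
  exact ⟨contract4_weylForm_psi0, contract4_weylForm_psi1, contract4_weylForm_psi3⟩

theorem Psi2_eq (h : w.RegularAt (zetaOf x) (uOf x)) (hε : w.ε = 0 ∨ w.ε = 1) :
    Psi2 w.metric w.m w.l kField x = ((-(1 / 6) * w.defect (uOf x)
      * (w.P (zetaOf x) ^ 2 / w.Q (zetaOf x) (uOf x) ^ 2) : ℝ) : ℂ) := by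
  rw [Psi2, weyl_metric h hε, m_eq, l_eq, kField_eq]
  exact contract4_weylForm_psi2 h.P_ne h.Q_ne

theorem Psi4_eq (h : w.RegularAt (zetaOf x) (uOf x)) (hε : w.ε = 0 ∨ w.ε = 1) :
    Psi4 w.metric w.m w.l x = w.psi4 (zetaOf x) (uOf x) := by
  rw [Psi4, weyl_metric h hε, m_eq, l_eq, contract4_weylForm_psi4 h.P_ne h.Q_ne]
  have hP := h.P_ne
  have hQ := h.Q_ne
  apply Complex.ext
  · simp only [Complex.re_ofReal_mul, Complex.sub_re, Complex.ofReal_re, Complex.re_mul_ofReal,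
      Complex.I_re]
    field_simp
    ring
  · simp only [Complex.im_ofReal_mul, Complex.sub_im, Complex.ofReal_im, Complex.im_mul_ofReal,
      Complex.I_im]
    field_simp
    ring

theorem Phi_vanish (h : w.RegularAt (zetaOf x) (uOf x)) (hε : w.ε = 0 ∨ w.ε = 1) :
    Phi00 w.metric kField x = 0 ∧ Phi01 w.metric w.m kField x = 0 ∧
      Phi10 w.metric w.m kField x = 0 ∧ Phi02 w.metric w.m x = 0 ∧
      Phi20 w.metric w.m x = 0 ∧ Phi12 w.metric w.m w.l x = 0 ∧
      Phi21 w.metric w.m w.l x = 0 := by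
  obtain ⟨a, b, c, hS, -, -⟩ := (curvature_metric h hε rfl rfl rfl).2.2
  rw [Phi00, Phi01, Phi10, Phi02, Phi20, Phi12, Phi21, hS, m_eq, l_eq, kField_eq, contract2_kk,
    contract2_km, contract2_kmbar, contract2_mm, contract2_mbarmbar, contract2_lm,
    contract2_lmbar]
  simp

theorem Phi11_eq (h : w.RegularAt (zetaOf x) (uOf x)) (hε : w.ε = 0 ∨ w.ε = 1) :
    Phi11 w.metric w.m w.l kField x = (((1 / 2) * w.ε * (w.α + w.β)
      * (w.P (zetaOf x) / w.Q (zetaOf x) (uOf x)) - (1 / 4) * w.defect (uOf x)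
        * (w.P (zetaOf x) ^ 2 / w.Q (zetaOf x) (uOf x) ^ 2) : ℝ) : ℂ) := by
  obtain ⟨a, b, c, hS, h1, -⟩ := (curvature_metric h hε rfl rfl rfl).2.2
  rw [Phi11, hS, m_eq, l_eq, kField_eq, contract2_kl, contract2_mmbar, ← Complex.ofReal_add, h1]
  push_cast
  ring

theorem Phi22_eq (h : w.RegularAt (zetaOf x) (uOf x)) (hε : w.ε = 0 ∨ w.ε = 1) {P Q : ℝ}
    (hP : P = w.P (zetaOf x)) (hQ : Q = w.Q (zetaOf x) (uOf x)) :
    Phi22 w.metric w.l x = (1 / 2) *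
      ((((w.ε * (w.α - w.β) * (1 - w.α * Complex.normSq (zetaOf x))
            + 2 * w.α * (2 * (w.C (uOf x) * zetaOf x).re)) * w.H (zetaOf x) (uOf x) : ℝ) : ℂ)
        + ((P ^ 2 * Q : ℝ) : ℂ)
          * dZeta (dZetaBar (fun z => ((w.H z (uOf x) : ℝ) : ℂ))) (zetaOf x)
        - ((2 * w.ε * (w.α + w.β) * vOf x * (2 * (deriv w.C (uOf x) * zetaOf x).re) : ℝ) : ℂ))
      * ((P ^ 3 / Q ^ 4 : ℝ) : ℂ) := by
  obtain ⟨a, b, c, hS, -, h1⟩ := (curvature_metric h hε hP hQ rfl).2.2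
  rw [Phi22, hS, l_eq, ← hP, ← hQ, contract2_ll, h1]
  ring

theorem defect_eq_zero_iff {u : ℝ} : w.defect u = 0 ↔ w.D u = w.D₀ u := by
  rw [defect, D₀]
  constructor <;> intro h <;> linarith

theorem Psi2_eq_zero_iff (h : w.RegularAt (zetaOf x) (uOf x)) (hε : w.ε = 0 ∨ w.ε = 1) :
    w.D (uOf x) = w.D₀ (uOf x) ↔ Psi2 w.metric w.m w.l kField x = 0 := by
  rw [Psi2_eq h hε, Complex.ofReal_eq_zero, ← defect_eq_zero_iff]
  simp [h.P_ne, h.Q_ne]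

/-- The Petrov type is governed by `D - D₀` and `Ψ₄`. -/
theorem petrovType (h : w.RegularAt (zetaOf x) (uOf x)) (hε : w.ε = 0 ∨ w.ε = 1) :
    (w.D (uOf x) ≠ w.D₀ (uOf x) → w.psi4 (zetaOf x) (uOf x) ≠ 0 →
      HasPetrovType (w.metric x) (weyl w.metric x) .II) ∧
    (w.D (uOf x) ≠ w.D₀ (uOf x) → w.psi4 (zetaOf x) (uOf x) = 0 →
      HasPetrovType (w.metric x) (weyl w.metric x) .D) ∧
    (w.D (uOf x) = w.D₀ (uOf x) → w.psi4 (zetaOf x) (uOf x) ≠ 0 →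
      HasPetrovType (w.metric x) (weyl w.metric x) .N) ∧
    (HasPetrovType (w.metric x) (weyl w.metric x) .O ↔
      w.D (uOf x) = w.D₀ (uOf x) ∧ w.psi4 (zetaOf x) (uOf x) = 0) := by
  have hP := h.P_ne
  have hQ := h.Q_ne
  have hp0 : 2 / w.P (zetaOf x) ^ 2 ≠ 0 := by positivity
  have hq0 : w.Q (zetaOf x) (uOf x) ^ 2 / w.P (zetaOf x) ^ 2 ≠ 0 := by positivity
  have hψ : -(1 / 6) * w.defect (uOf x) * (w.P (zetaOf x) ^ 2 / w.Q (zetaOf x) (uOf x) ^ 2) = 0 ↔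
      w.D (uOf x) = w.D₀ (uOf x) := by
    rw [← defect_eq_zero_iff]
    simp [hP, hQ]
  have hST : 2 * w.Q (zetaOf x) (uOf x) ^ 4 / w.P (zetaOf x) ^ 6
        * (w.psi4 (zetaOf x) (uOf x)).re = 0 ∧
      -(2 * w.Q (zetaOf x) (uOf x) ^ 4 / w.P (zetaOf x) ^ 6
        * (w.psi4 (zetaOf x) (uOf x)).im) = 0 ↔ w.psi4 (zetaOf x) (uOf x) = 0 := by
    rw [Complex.ext_iff]
    simp [hP, hQ]
  rw [metric_eq_block, weyl_metric h hε]
  simp only [ne_eq]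
  rw [← hψ, ← hST]
  refine ⟨hasPetrovType_II hp0 hq0, fun h1 h2 => ?_, fun h1 h2 => ?_,
    hasPetrovType_O_iff hp0 hq0⟩
  · rw [h2.1, h2.2]
    exact hasPetrovType_D hp0 hq0 h1
  · rw [h1]
    exact hasPetrovType_N hp0 hq0 h2

end WaveData

end KundtWaves

/-! ### The theorem -/

open KundtWaves

theorem mainTheorem2 (w : WaveData) (hε : w.ε = 0 ∨ w.ε = 1)
    (S : Set (ℂ × ℝ)) (hS : IsOpen S)
    (hP : ∀ q ∈ S, w.P q.1 ≠ 0) (hQ : ∀ q ∈ S, w.Q q.1 q.2 ≠ 0)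
    (hC : ContDiffOn ℝ 3 w.C (Prod.snd '' S))
    (hD : ContDiffOn ℝ 2 w.D (Prod.snd '' S))
    (hH : ContDiffOn ℝ 2 (fun q : ℂ × ℝ => w.H q.1 q.2) S) :
    -- the natural tetrad is a null tetrad
    (∀ x ∈ domainOver S, IsNullTetrad (w.metric x) (w.m x) (w.l x) (kField x)) ∧
    -- vanishing spin coefficients
    (∀ x ∈ domainOver S,
      spinRho w.metric w.m kField x = 0 ∧
      spinSigma w.metric w.m kField x = 0 ∧
      spinKappa w.metric w.m kField x = 0) ∧
    -- the Kundt class; algebraic speciality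
    IsKundtCongruence w.metric (domainOver S) kField ∧
    InKundtClass w.metric (domainOver S) ∧
    (∀ x ∈ domainOver S, PNDMultiplicityGE (w.metric x) (weyl w.metric x) (kField x) 2) ∧
    -- the vanishing curvature scalars
    (∀ x ∈ domainOver S,
      Psi0 w.metric w.m kField x = 0 ∧
      Psi1 w.metric w.m w.l kField x = 0 ∧
      Psi3 w.metric w.m w.l kField x = 0 ∧
      Phi00 w.metric kField x = 0 ∧
      Phi01 w.metric w.m kField x = 0 ∧
      Phi10 w.metric w.m kField x = 0 ∧
      Phi02 w.metric w.m x = 0 ∧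
      Phi20 w.metric w.m x = 0 ∧
      Phi12 w.metric w.m w.l x = 0 ∧
      Phi21 w.metric w.m w.l x = 0) ∧
    -- the other curvature scalars
    (∀ x ∈ domainOver S, ∀ (ζ : ℂ) (u v P Q : ℝ), ζ = zetaOf x → u = uOf x → v = vOf x →
      P = w.P ζ → Q = w.Q ζ u →
      Psi2 w.metric w.m w.l kField x =
        ((-(1 / 6) * (w.D u + 2 * w.ε * w.β - 2 * Complex.normSq (w.C u))
          * (P ^ 2 / Q ^ 2) : ℝ) : ℂ) ∧
      Psi4 w.metric w.m w.l x =
        (1 / 2) * dZeta (dZeta (fun z => ((w.P z * w.H z u : ℝ) : ℂ))) ζ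
          * ((P ^ 4 / Q ^ 3 : ℝ) : ℂ) ∧
      scalarCurv w.metric x =
        24 * w.α - 12 * w.ε * (w.α + w.β) * (P / Q)
          + 2 * (w.D u + 2 * w.ε * w.β - 2 * Complex.normSq (w.C u)) * (P ^ 2 / Q ^ 2) ∧
      Phi11 w.metric w.m w.l kField x =
        (((1 / 2) * w.ε * (w.α + w.β) * (P / Q)
          - (1 / 4) * (w.D u + 2 * w.ε * w.β - 2 * Complex.normSq (w.C u))
            * (P ^ 2 / Q ^ 2) : ℝ) : ℂ) ∧
      Phi22 w.metric w.l x =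
        (1 / 2) *
          ((((w.ε * (w.α - w.β) * (1 - w.α * Complex.normSq ζ)
                + 2 * w.α * (2 * (w.C u * ζ).re)) * w.H ζ u : ℝ) : ℂ)
            + ((P ^ 2 * Q : ℝ) : ℂ) * dZeta (dZetaBar (fun z => ((w.H z u : ℝ) : ℂ))) ζ
            - ((2 * w.ε * (w.α + w.β) * v * (2 * (deriv w.C u * ζ).re) : ℝ) : ℂ))
          * ((P ^ 3 / Q ^ 4 : ℝ) : ℂ)) ∧
    -- the Petrov type at each point
    (∀ x ∈ domainOver S,
      (w.D (uOf x) = w.D₀ (uOf x) ↔ Psi2 w.metric w.m w.l kField x = 0) ∧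
      (w.D (uOf x) ≠ w.D₀ (uOf x) → Psi4 w.metric w.m w.l x ≠ 0 →
        HasPetrovType (w.metric x) (weyl w.metric x) .II) ∧
      (w.D (uOf x) ≠ w.D₀ (uOf x) → Psi4 w.metric w.m w.l x = 0 →
        HasPetrovType (w.metric x) (weyl w.metric x) .D) ∧
      (w.D (uOf x) = w.D₀ (uOf x) → Psi4 w.metric w.m w.l x ≠ 0 →
        HasPetrovType (w.metric x) (weyl w.metric x) .N) ∧
      (HasPetrovType (w.metric x) (weyl w.metric x) .O ↔
        w.D (uOf x) = w.D₀ (uOf x) ∧ Psi4 w.metric w.m w.l x = 0)) ∧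
    -- the table: `H = H₀`
    (w.IsH₀ S → ∀ x ∈ domainOver S,
      Psi4 w.metric w.m w.l x = 0 ∧
      (w.D (uOf x) = w.D₀ (uOf x) → HasPetrovType (w.metric x) (weyl w.metric x) .O) ∧
      (w.D (uOf x) ≠ w.D₀ (uOf x) → HasPetrovType (w.metric x) (weyl w.metric x) .D)) ∧
    -- the table: `H ≠ H₀`
    ((∀ u, IsPreconnected {ζ : ℂ | (ζ, u) ∈ S}) → ¬ w.IsH₀ S →
      ∃ N ⊆ domainOver S, IsOpen N ∧ N.Nonempty ∧ ∀ x ∈ N,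
        Psi4 w.metric w.m w.l x ≠ 0 ∧
        (w.D (uOf x) = w.D₀ (uOf x) → HasPetrovType (w.metric x) (weyl w.metric x) .N) ∧
        (w.D (uOf x) ≠ w.D₀ (uOf x) → HasPetrovType (w.metric x) (weyl w.metric x) .II)) := by
  have h := WaveData.regularAt_of_contDiffOn hS hP hQ hC hD hH
  have hK := WaveData.isKundtCongruence h
  refine ⟨fun x hx => WaveData.isNullTetrad (h _ hx), fun x hx =>
    WaveData.spin_coefficients (h _ hx), hK, ⟨_, hK⟩, fun x hx => ?_, fun x hx => ?_, ?_,
    fun x hx => ?_, fun hH₀ x hx => ?_, fun hconn hH₀ => ?_⟩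
  · rw [WaveData.weyl_metric (h _ hx) hε, WaveData.metric_eq_block, WaveData.kField_eq]
    exact pnd_k_two
  · obtain ⟨h0, h1, h3⟩ := WaveData.Psi_vanish (h _ hx) hε
    exact ⟨h0, h1, h3, WaveData.Phi_vanish (h _ hx) hε⟩
  · rintro x hx ζ u v P Q rfl rfl rfl rfl rfl
    exact ⟨WaveData.Psi2_eq (h _ hx) hε, WaveData.Psi4_eq (h _ hx) hε,
      (WaveData.curvature_metric (h _ hx) hε rfl rfl rfl).2.1, WaveData.Phi11_eq (h _ hx) hε,
      WaveData.Phi22_eq (h _ hx) hε rfl rfl⟩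
  · rw [WaveData.Psi4_eq (h _ hx) hε]
    exact ⟨WaveData.Psi2_eq_zero_iff (h _ hx) hε, WaveData.petrovType (h _ hx) hε⟩
  · obtain ⟨-, hD', -, hO⟩ := WaveData.petrovType (h _ hx) hε
    have h0 := WaveData.psi4_eq_zero_of_isH₀ hS h hH₀ hx
    rw [WaveData.Psi4_eq (h _ hx) hε]
    exact ⟨h0, fun hd => hO.2 ⟨hd, h0⟩, fun hd => hD' hd h0⟩
  · obtain ⟨q, hq, hq0⟩ : ∃ q ∈ S, w.psi4 q.1 q.2 ≠ 0 := by
      by_contra! h0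
      exact hH₀ (WaveData.isH₀_of_psi4_eq_zero hS h hconn h0)
    -- `Ψ₄` does not depend on `v`, so the witness point may be taken at `v = 0`.
    refine ⟨_, fun x hx => hx.1, WaveData.isOpen_psi4_ne_zero hS h,
      ⟨![q.1.re, q.1.im, q.2, 0], hq, hq0⟩, fun x hx => ?_⟩
    obtain ⟨hII, -, hN, -⟩ := WaveData.petrovType (h _ hx.1) hε
    rw [WaveData.Psi4_eq (h _ hx.1) hε]
    exact ⟨hx.2, fun hd => hN hd hx.2, fun hd => hII hd hx.2⟩
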